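/- Fix a countably infinite set of message tags. A *session type* is a possibly infinite tree generated by $S ::= \mathsf{end} \mid \sum_{a\in I} p\,a.S_a$, where $I$ is a finite nonempty set of tags and the polarity $p$ is either $?$ (input) or $!$ (output), such that every subtree contains a leaf $\mathsf{end}$. Write $S \xrightarrow{p\,a} T$ for the relation defined coinductively by the rules - $\sum_{b\in I} p\,b.S_b \xrightarrow{p\,a} S_a$ for $a\in I$; - if $S_b \xrightarrow{?a} T_b$ for all $b\in I$, then $\sum_{b\in I} !b.S_b \xrightarrow{?a} \sum_{b\in I} !b.T_b$. Let $\mathrm{out}(S)$ and $\mathrm{inp}(S)$ be the sets of tags $a$ such that $S$ has a transition labelled $!a$, respectively $?a$. A session $S\,|\,T$ with $\mathrm{out}(S)\subseteq\mathrm{inp}(T)$ and $\mathrm{out}(T)\subseteq\mathrm{inp}(S)$ reduces to $S'\,|\,T'$ if $S$ and $T$ have transitions with dual labels to $S'$ and $T'$. The types $S$ and $T$ *compose correctly* if $S\,|\,T\to^* S'\,|\,T'$ always implies $S'\,|\,T'\to^*\mathsf{end}\,|\,\mathsf{end}$. They are *compliant* if, in the semantics where the two types communicate asynchronously through two unbounded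 FIFO queues (one for the messages to each type), every configuration reachable from $S$, $T$ with empty queues can reach $\mathsf{end}$, $\mathsf{end}$ with empty queues. **Theorem.** (1) The problem of checking the correct composition of two types is undecidable: there is no algorithm that, given two session types presented by finite systems of guarded equations, decides whether they compose correctly. The same holds for compliance. (2) Let $M=(Q,\Sigma,\Gamma,\$,s,\delta)$ be a queue machine: $Q$, $\Gamma$ are finite, $\Sigma\subseteq\Gamma$, $\$\in\Gamma\setminus\Sigma$, $s\in Q$, $\delta:Q\times\Gamma\to Q\times\Gamma^*$; a step is $(p,A\alpha)\to_M(q,\alpha\gamma)$ if $\delta(p,A)=(q,\gamma)$, and $M$ accepts $x\in\Sigma^*$ if $(s,x\$)\to_M^*(q,\varepsilon)$ for some $q$. Regard the symbols of $\Gamma$ as pairwise distinct tags, and let $E\neq E'$ be tags outside $\Gamma$. For $x=X_1\cdots X_n\in\Sigma^*$ and $p\in Q$ let $$T^M_x = {!}X_1.\cdots.{!}X_n.{!}\$.{!}E.T^M,$$ $$T^M = \textstyle\sum_{A\in\Gamma}{?}A.{!}A.T^M + {?}E.{!}E.T^M_E,\qquad T^M_E = \sum_{A\in\Gamma}{?}A.{!}A.T^M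 + {?}E.{!}E'.\mathsf{end},$$ $$S^M_p = \textstyle\sum_{A\in\Gamma}{?}A.{!}B_1.\cdots.{!}B_m.S^M_q + {?}E.{!}E.S^M_p + {?}E'.\mathsf{end}\quad\text{where } \delta(p,A)=(q,B_1\cdots B_m).$$ These are session types, and $M$ accepts $x$ if and only if $S^M_s$ and $T^M_x$ compose correctly, and also if and only if they are compliant. -/

import Mathlib

/-! Binary asynchronous session types, their correct composition, and queue machines. -/

namespace SessionTypes

open Relation

/-- Polarity of an action: `inp` is `?`, `out` is `!`. -/
inductive Polarity where
  | inp
  | out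

/-- `?` and `!` are dual to each other. -/
def Polarity.dual : Polarity → Polarity
  | .inp => .out
  | .out => .inp

/-- Message tags. -/
abbrev Tag : Type := ℕ

/-- Label of a node of a session tree: either the leaf `end`, or a choice with polarity `p` among
the tags of a finite nonempty set `I`. -/
inductive Head where
  | fin
  | choice (p : Polarity) (I : Finset Tag) (h : I.Nonempty)

/-- A leaf has no branches; a choice among the tags of `I` has one branch for each tag of `I`. -/
def Head.Branch : Head → Type
  | .fin => Empty
  | .choice _ I _ => {a : Tag // a ∈ I}

/-- The possibly infinite trees generated coinductively by
`S ::= end | ∑_{a ∈ I} p a . S_a`, with `I` finite and nonempty. -/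
def Tree : Type := PFunctor.M ⟨Head, Head.Branch⟩

/-- The tree `end`. -/
def Tree.done : Tree := PFunctor.M.mk ⟨Head.fin, Empty.elim⟩

/-- The tree `∑_{a ∈ I} p a . k a` (the values of `k` outside `I` are irrelevant). -/
def Tree.choice (p : Polarity) (I : Finset Tag) (h : I.Nonempty) (k : Tag → Tree) : Tree :=
  PFunctor.M.mk ⟨Head.choice p I h, fun a => k a.1⟩

/-- The tree `! a . S`. -/
def Tree.send (a : Tag) (S : Tree) : Tree :=
  Tree.choice .out {a} (Finset.singleton_nonempty a) (fun _ => S)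

/-- The tree `! a₁ . ⋯ . ! aₙ . S`. -/
def Tree.sendAll (w : List Tag) (S : Tree) : Tree := w.foldr Tree.send S

/-- The immediate subtree relation. -/
inductive Child : Tree → Tree → Prop
  | mk (p : Polarity) (I : Finset Tag) (h : I.Nonempty) (k : Tag → Tree) (a : Tag) (ha : a ∈ I) :
      Child (Tree.choice p I h k) (k a)

/-- A session type is a tree each of whose subtrees contains a leaf `end`. -/
def IsSessionType (S : Tree) : Prop :=
  ∀ T, ReflTransGen Child S T → ReflTransGen Child T Tree.done

/-! ### Asynchronous labelled transition system and correct composition -/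

/-- The two rules for deriving transitions with polarity `p` and tag `a`; `R` is the relation that
the premises of the second rule refer to.
* `sync`: `∑_{b ∈ I} p b . k b --p a--> k a` for `a ∈ I`;
* `async`: if `k b --?a--> k' b` for all `b ∈ I`, then
  `∑_{b ∈ I} ! b . k b --?a--> ∑_{b ∈ I} ! b . k' b`. -/
inductive TransRule (R : Tree → Tree → Prop) : Polarity → Tag → Tree → Tree → Prop
  | sync (p : Polarity) (I : Finset Tag) (h : I.Nonempty) (k : Tag → Tree) (a : Tag) (ha : a ∈ I) :
      TransRule R p a (Tree.choice p I h k) (k a)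
  | async (I : Finset Tag) (h : I.Nonempty) (k k' : Tag → Tree) (a : Tag)
      (hR : ∀ b ∈ I, R (k b) (k' b)) :
      TransRule R .inp a (Tree.choice .out I h k) (Tree.choice .out I h k')

/-- `S --p a--> T`: the relation defined coinductively by the two rules above, that is, the largest
relation each of whose pairs is the conclusion of a rule with premises in the relation. -/
def Trans (p : Polarity) (a : Tag) (S T : Tree) : Prop :=
  ∃ R : Tree → Tree → Prop, R S T ∧ ∀ S' T', R S' T' → TransRule R p a S' T'

/-- The tags that `S` can output. -/
def outTags (S : Tree) : Set Tag := {a | ∃ T, Trans .out a S T}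

/-- The tags that `S` can input. -/
def inpTags (S : Tree) : Set Tag := {a | ∃ T, Trans .inp a S T}

/-- Reduction of sessions `S | T`: the two components perform dual transitions, provided that each
of them is able to input all the tags that the other one can output. -/
def SessionStep (c d : Tree × Tree) : Prop :=
  outTags c.1 ⊆ inpTags c.2 ∧ outTags c.2 ⊆ inpTags c.1 ∧
    ∃ (p : Polarity) (a : Tag), Trans p a c.1 d.1 ∧ Trans p.dual a c.2 d.2

/-- `S` and `T` compose correctly: every session reachable from `S | T` can reduce to
`end | end`. -/
def CorrectComposition (S T : Tree) : Prop :=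
  ∀ c, ReflTransGen SessionStep (S, T) c → ReflTransGen SessionStep c (Tree.done, Tree.done)

/-! ### Buffer-based semantics and compliance -/

/-- A configuration `⟨left, leftQueue⟩ | ⟨right, rightQueue⟩`; each queue holds the messages sent to
the adjacent type and not yet received by it, the oldest one first. -/
structure Config where
  left : Tree
  leftQueue : List Tag
  right : Tree
  rightQueue : List Tag

/-- Reduction of configurations: an output appends a message to the queue of the other type, an
input removes the first message from the own queue. -/
inductive ConfigStep : Config → Config → Prop
  | leftSend (I : Finset Tag) (h : I.Nonempty) (k : Tag → Tree) (a : Tag) (ha : a ∈ I)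
      (v : List Tag) (T : Tree) (w : List Tag) :
      ConfigStep ⟨Tree.choice .out I h k, v, T, w⟩ ⟨k a, v, T, w ++ [a]⟩
  | leftReceive (I : Finset Tag) (h : I.Nonempty) (k : Tag → Tree) (a : Tag) (ha : a ∈ I)
      (v : List Tag) (T : Tree) (w : List Tag) :
      ConfigStep ⟨Tree.choice .inp I h k, a :: v, T, w⟩ ⟨k a, v, T, w⟩
  | rightSend (I : Finset Tag) (h : I.Nonempty) (k : Tag → Tree) (a : Tag) (ha : a ∈ I)
      (S : Tree) (v : List Tag) (w : List Tag) :
      ConfigStep ⟨S, v, Tree.choice .out I h k, w⟩ ⟨S, v ++ [a], k a, w⟩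
  | rightReceive (I : Finset Tag) (h : I.Nonempty) (k : Tag → Tree) (a : Tag) (ha : a ∈ I)
      (S : Tree) (v : List Tag) (w : List Tag) :
      ConfigStep ⟨S, v, Tree.choice .inp I h k, a :: w⟩ ⟨S, v, k a, w⟩

/-- `S` and `T` are compliant: every configuration reachable from `⟨S, ε⟩ | ⟨T, ε⟩` can reduce to
`⟨end, ε⟩ | ⟨end, ε⟩`. -/
def Compliant (S T : Tree) : Prop :=
  ∀ c, ReflTransGen ConfigStep ⟨S, [], T, []⟩ c →
    ReflTransGen ConfigStep c ⟨Tree.done, [], Tree.done, []⟩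

/-! ### Systems of guarded equations and their solutions -/

/-- Right-hand side of a guarded equation with unknowns in `X`: either `end` or
`∑_{a ∈ I} p a . k a` (the values of `k` outside `I` are irrelevant). -/
inductive Rhs (X : Type*) where
  | fin
  | choice (p : Polarity) (I : Finset Tag) (h : I.Nonempty) (k : Tag → X)

/-- A right-hand side as an object of the polynomial functor of session trees. -/
def Rhs.toObj {X : Type*} : Rhs X → PFunctor.Obj ⟨Head, Head.Branch⟩ X
  | .fin => ⟨Head.fin, Empty.elim⟩
  | .choice p I h k => ⟨Head.choice p I h, fun a => k a.1⟩

/-- The solution of the system of equations `x = eqs x`. -/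
def solve {X : Type*} (eqs : X → Rhs X) : X → Tree :=
  PFunctor.M.corec (fun x => (eqs x).toObj)

theorem solve_fin {X : Type*} (eqs : X → Rhs X) (x : X) (hx : eqs x = .fin) :
    solve eqs x = Tree.done := by
  rw [← PFunctor.M.mk_dest (solve eqs x)]
  refine congrArg PFunctor.M.mk ?_
  simp only [solve, PFunctor.M.dest_corec, hx, Rhs.toObj]
  refine Sigma.ext rfl (heq_of_eq ?_)
  funext a
  exact a.elim

theorem solve_choice {X : Type*} (eqs : X → Rhs X) (x : X) (p : Polarity) (I : Finset Tag)
    (h : I.Nonempty) (k : Tag → X) (hx : eqs x = .choice p I h k) :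
    solve eqs x = Tree.choice p I h (fun a => solve eqs (k a)) := by
  rw [← PFunctor.M.mk_dest (solve eqs x)]
  refine congrArg PFunctor.M.mk ?_
  simp only [solve, PFunctor.M.dest_corec, hx, Rhs.toObj]
  rfl

/-! ### Finite presentations and undecidability -/

/-- A finite system of equations: the `n`-th entry is the right-hand side of the equation for the
`n`-th unknown. The entry `none` stands for `end`; the entry `some (b, l)` stands for the choice
whose branches `(a, m)` in `l` consist of a tag `a` and the number `m` of the unknown that follows
it; it is an output if `b = true` and an input if `b = false`. -/
abbrev EqSystem : Type := List (Option (Bool × List (ℕ × ℕ)))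

/-- A finite presentation of a session type: a finite system of equations and the number of the
unknown whose solution is meant. -/
abbrev Code : Type := EqSystem × ℕ

/-- Right-hand side of the `n`-th equation (`end` if the entry is missing or has no branch). -/
def EqSystem.rhs (E : EqSystem) (n : ℕ) : Rhs ℕ :=
  match E[n]? with
  | some (some (b, l)) =>
      if h : (l.map Prod.fst).toFinset.Nonempty then
        .choice (if b then .out else .inp) (l.map Prod.fst).toFinset h
          (fun a => (l.lookup a).getD 0)
      else .fin
  | _ => .fin

/-- The tree presented by a code. -/
def Code.tree (c : Code) : Tree := solve (EqSystem.rhs c.1) c.2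

/-- `c` is a proper presentation of a session type: all the unknowns that occur have an equation,
the branches of each choice are nonempty with pairwise distinct tags, and each subtree of the
presented tree contains a leaf `end`. -/
def Code.WellFormed (c : Code) : Prop :=
  c.2 < c.1.length ∧
  (∀ (b : Bool) (l : List (ℕ × ℕ)), some (b, l) ∈ c.1 →
    l ≠ [] ∧ (l.map Prod.fst).Nodup ∧ ∀ e ∈ l, e.2 < c.1.length) ∧
  IsSessionType c.tree

/-- `P` is undecidable on session types: no algorithm halts with the correct answer on all pairs of
finite presentations of session types (whatever it does on ill-formed presentations). -/
def UndecidableOnSessionTypes (P : Tree → Tree → Prop) : Prop :=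
  ¬ ∃ f : Code × Code →. Bool, Partrec f ∧
    ∀ c d : Code, c.WellFormed → d.WellFormed →
      ∃ b : Bool, b ∈ f (c, d) ∧ (b = true ↔ P c.tree d.tree)

/-! ### Queue machines -/

/-- A queue machine with finite set of states `Q` and finite queue alphabet `Γ`. -/
structure QueueMachine (Q Γ : Type*) [Fintype Q] [Fintype Γ] where
  /-- the input alphabet -/
  input : Set Γ
  /-- the initial queue symbol -/
  dollar : Γ
  dollar_notMem : dollar ∉ input
  /-- the start state -/
  start : Q
  /-- the transition function -/
  δ : Q → Γ → Q × List Γ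

namespace QueueMachine

variable {Q Γ : Type*} [Fintype Q] [Fintype Γ]

/-- The transition relation between configurations `(state, queue)`. -/
inductive Step (M : QueueMachine Q Γ) : Q × List Γ → Q × List Γ → Prop
  | mk (p : Q) (A : Γ) (w : List Γ) : Step M (p, A :: w) ((M.δ p A).1, w ++ (M.δ p A).2)

/-- `M` accepts `x` if it reaches the empty queue from `(start, x $)`. -/
def Accepts (M : QueueMachine Q Γ) (x : List Γ) : Prop :=
  ∃ q : Q, ReflTransGen M.Step (M.start, x ++ [M.dollar]) (q, [])

end QueueMachine

/-! ### Encoding of queue machines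

Symbols of `Γ` are used as tags through an injection `e`, and `E`, `E'` are two further tags. -/

section Encoding

variable {Q Γ : Type*} [Fintype Q] [Fintype Γ]

/-- The tags of the symbols of `Γ`, and `E`. -/
def forwarderTags (e : Γ ↪ Tag) (E : Tag) : Finset Tag := insert E (Finset.univ.map e)

/-- The tags of the symbols of `Γ`, and `E`, `E'`. -/
def machineTags (e : Γ ↪ Tag) (E E' : Tag) : Finset Tag :=
  insert E' (insert E (Finset.univ.map e))

theorem forwarderTags_nonempty (e : Γ ↪ Tag) (E : Tag) : (forwarderTags e E).Nonempty :=
  Finset.insert_nonempty _ _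

theorem machineTags_nonempty (e : Γ ↪ Tag) (E E' : Tag) : (machineTags e E E').Nonempty :=
  Finset.insert_nonempty _ _

/-- The unknowns `T^M`, `T^M_E` and `end` of the forwarder's equations. -/
inductive ForwarderState where
  | main
  | seen
  | halt

/-- The equations of the forwarder; the unknown `(w, s)` stands for `! w₁ . ⋯ . ! wₙ . s`. -/
def forwarderEqs (e : Γ ↪ Tag) (E E' : Tag) :
    List Tag × ForwarderState → Rhs (List Tag × ForwarderState)
  | (a :: w, s) => .choice .out {a} (Finset.singleton_nonempty a) (fun _ => (w, s))
  | ([], .main) => .choice .inp (forwarderTags e E) (forwarderTags_nonempty e E)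
      (fun a => if a = E then ([E], .seen) else ([a], .main))
  | ([], .seen) => .choice .inp (forwarderTags e E) (forwarderTags_nonempty e E)
      (fun a => if a = E then ([E'], .halt) else ([a], .main))
  | ([], .halt) => .fin

/-- `T^M`. -/
def forwarderMain (e : Γ ↪ Tag) (E E' : Tag) : Tree :=
  solve (forwarderEqs e E E') ([], .main)

/-- `T^M_E`. -/
def forwarderSeen (e : Γ ↪ Tag) (E E' : Tag) : Tree :=
  solve (forwarderEqs e E E') ([], .seen)

/-- `T^M_x = ! X₁ . ⋯ . ! Xₙ . ! $ . ! E . T^M` for `x = X₁ ⋯ Xₙ`. -/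
def forwarderType (M : QueueMachine Q Γ) (e : Γ ↪ Tag) (E E' : Tag) (x : List Γ) : Tree :=
  Tree.sendAll (x.map e ++ [e M.dollar, E]) (forwarderMain e E E')

/-- The equations of the machine; the unknown `(w, some p)` stands for
`! w₁ . ⋯ . ! wₙ . S^M_p`, the unknown `(w, none)` for `! w₁ . ⋯ . ! wₙ . end`. -/
noncomputable def machineEqs (M : QueueMachine Q Γ) (e : Γ ↪ Tag) (E E' : Tag) :
    List Tag × Option Q → Rhs (List Tag × Option Q)
  | (a :: w, s) => .choice .out {a} (Finset.singleton_nonempty a) (fun _ => (w, s))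
  | ([], some p) => .choice .inp (machineTags e E E') (machineTags_nonempty e E E')
      (fun a =>
        if a = E then ([E], some p)
        else if a = E' then ([], none)
        else match Function.partialInv e a with
          | some A => ((M.δ p A).2.map e, some (M.δ p A).1)
          | none => ([], none))
  | ([], none) => .fin

/-- `S^M_p`. -/
noncomputable def machineType (M : QueueMachine Q Γ) (e : Γ ↪ Tag) (E E' : Tag) (p : Q) : Tree :=
  solve (machineEqs M e E E') ([], some p)

theorem solve_forwarderEqs (e : Γ ↪ Tag) (E E' : Tag) (w : List Tag) (s : ForwarderState) :
    solve (forwarderEqs e E E') (w, s) =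
      Tree.sendAll w (solve (forwarderEqs e E E') ([], s)) := by
  induction w with
  | nil => rfl
  | cons a w ih => rw [solve_choice _ _ _ _ _ _ rfl, ih]; rfl

theorem solve_machineEqs (M : QueueMachine Q Γ) (e : Γ ↪ Tag) (E E' : Tag) (w : List Tag)
    (s : Option Q) :
    solve (machineEqs M e E E') (w, s) =
      Tree.sendAll w (solve (machineEqs M e E E') ([], s)) := by
  induction w with
  | nil => rfl
  | cons a w ih => rw [solve_choice _ _ _ _ _ _ rfl, ih]; rfl

/-- `T^M = ∑_{A ∈ Γ} ? A . ! A . T^M + ? E . ! E . T^M_E`. -/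
theorem forwarderMain_eq (e : Γ ↪ Tag) (E E' : Tag) :
    forwarderMain e E E' =
      Tree.choice .inp (forwarderTags e E) (forwarderTags_nonempty e E)
        (fun a => if a = E then Tree.send E (forwarderSeen e E E')
          else Tree.send a (forwarderMain e E E')) := by
  refine (solve_choice _ _ _ _ _ _ rfl).trans ?_
  congr 1
  funext a
  split_ifs <;> rw [solve_forwarderEqs] <;> rfl

/-- `T^M_E = ∑_{A ∈ Γ} ? A . ! A . T^M + ? E . ! E' . end`. -/
theorem forwarderSeen_eq (e : Γ ↪ Tag) (E E' : Tag) :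
    forwarderSeen e E E' =
      Tree.choice .inp (forwarderTags e E) (forwarderTags_nonempty e E)
        (fun a => if a = E then Tree.send E' Tree.done
          else Tree.send a (forwarderMain e E E')) := by
  refine (solve_choice _ _ _ _ _ _ rfl).trans ?_
  congr 1
  funext a
  split_ifs <;> rw [solve_forwarderEqs]
  · rw [solve_fin _ _ rfl]; rfl
  · rfl

/-- `S^M_p = ∑_{A ∈ Γ} ? A . ! B₁ . ⋯ . ! Bₙ . S^M_q + ? E . ! E . S^M_p + ? E' . end`, where
`δ (p, A) = (q, B₁ ⋯ Bₙ)`. -/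
theorem machineType_eq (M : QueueMachine Q Γ) (e : Γ ↪ Tag) (E E' : Tag)
    (hE : E ∉ Set.range e) (hE' : E' ∉ Set.range e) (hEE' : E ≠ E') (p : Q) :
    ∃ k : Tag → Tree,
      machineType M e E E' p =
        Tree.choice .inp (machineTags e E E') (machineTags_nonempty e E E') k ∧
      (∀ A : Γ, k (e A) =
        Tree.sendAll ((M.δ p A).2.map e) (machineType M e E E' (M.δ p A).1)) ∧
      k E = Tree.send E (machineType M e E E' p) ∧
      k E' = Tree.done := by
  refine ⟨_, solve_choice _ _ _ _ _ _ rfl, fun A => ?_, ?_, ?_⟩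
  · have h1 : e A ≠ E := fun h => hE ⟨A, h⟩
    have h2 : e A ≠ E' := fun h => hE' ⟨A, h⟩
    simp only [if_neg h1, if_neg h2, Function.partialInv_left e.injective A]
    rw [solve_machineEqs]; rfl
  · simp only [if_true]
    rw [solve_machineEqs]; rfl
  · simp only [if_neg hEE'.symm, if_true]
    exact solve_fin _ _ rfl

end Encoding

end SessionTypes

namespace SessionTypes

open Relation

/-! ### Inversion of trees and of transitions -/

/-! Both types of the encoding alternate between input choices and finite words of outputs, so they
are transducers: read a tag, answer with a word (`Realizes`). For such types an input can be
performed underneath the pending outputs, and its answer joins the end of them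
(`Realizes.trans_inp_iff`). Pending outputs and queue contents therefore play the same role, and
both semantics reduce to one model: a ring of two transducers joined by two queues. Compliance
always amounts to correctness of the ring (`compliant_iff_ring`); for correct composition one also
needs an invariant excluding that an unexpected tag ever heads a queue
(`correctComposition_iff_ring`).

In the ring of the machine and the forwarder, the queue of `M` consists of the symbols on their way
to the machine followed by those on their way back. A single marker `E` circulates among them. When
the forwarder receives `E` twice with no symbol in between, the queue of `M` is empty, and it may
send `E'` and stop. `Encodes` is the invariant behind this: a step of the ring is at most one step
of `M` (`Encodes.step`), a step of `M` can be matched from every encoding ring (`Encodes.progress`),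
and an empty queue leads to termination (`Encodes.terminates`). Since `M` is deterministic, if it
accepts then every reachable ring can still follow the accepting run; conversely, a terminating run
of the ring traces an accepting run of `M` (`accepts_iff_ring`).

For undecidability one needs a fixed queue machine whose acceptance problem is undecidable. A
universal program, compiled to a multi-stack machine, is simulated by a queue machine that keeps all
the stacks interleaved in one queue (`respects_simulates`, `simMachine_accepts_iff`). Only the
output prefix of the forwarder depends on the input word, so the finite presentations are computable
from the input, and a decision procedure for either property would solve the halting problem. -/

theorem Tree.choice_inj {p q : Polarity} {I J : Finset Tag} {h : I.Nonempty} {h' : J.Nonempty}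
    {k l : Tag → Tree} (H : Tree.choice p I h k = Tree.choice q J h' l) :
    p = q ∧ I = J ∧ ∀ a ∈ I, k a = l a := by
  have H := PFunctor.M.mk_inj H
  have h1 := congrArg Sigma.fst H
  injection h1 with hp hI
  subst hp hI
  have h2 := eq_of_heq (Sigma.mk.inj H).2
  exact ⟨rfl, rfl, fun a ha => congrFun h2 ⟨a, ha⟩⟩

theorem Tree.choice_congr {p : Polarity} {I : Finset Tag} {h : I.Nonempty} {k l : Tag → Tree}
    (H : ∀ a ∈ I, k a = l a) : Tree.choice p I h k = Tree.choice p I h l :=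
  congrArg PFunctor.M.mk (Sigma.ext rfl (heq_of_eq (funext fun a => H a.1 a.2)))

theorem Tree.choice_ne_done {p : Polarity} {I : Finset Tag} {h : I.Nonempty} {k : Tag → Tree} :
    Tree.choice p I h k ≠ Tree.done := by
  intro H
  have h1 := congrArg Sigma.fst (PFunctor.M.mk_inj H)
  injection h1

theorem TransRule.mono {R R' : Tree → Tree → Prop} (H : ∀ S T, R S T → R' S T) {p : Polarity}
    {a : Tag} {S T : Tree} (h : TransRule R p a S T) : TransRule R' p a S T := by
  cases h with
  | sync p I h k a ha => exact .sync p I h k a ha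
  | async I h k k' a hR => exact .async I h k k' a fun b hb => H _ _ (hR b hb)

/-- The union of all relations consistent with the rules is itself consistent, hence a fixed point.
This unfolding is all that is used of coinduction: the output prefixes met below are finite, so
inversion can proceed by induction on them. -/
theorem trans_iff {p : Polarity} {a : Tag} {S T : Tree} :
    Trans p a S T ↔ TransRule (Trans p a) p a S T := by
  have key : ∀ S T, Trans p a S T → TransRule (Trans p a) p a S T := by
    rintro S T ⟨R, hR, hc⟩
    exact (hc _ _ hR).mono fun S' T' h => ⟨R, h, hc⟩
  exact ⟨key S T, fun h => ⟨_, h, fun S' T' h' => h'.mono key⟩⟩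

theorem trans_out_send {a b : Tag} {S T : Tree} :
    Trans .out a (Tree.send b S) T ↔ a = b ∧ T = S := by
  rw [trans_iff]
  constructor
  · intro h
    generalize hU : Tree.send b S = U at h
    cases h with
    | sync p I h k a ha =>
      obtain ⟨-, h1, h2⟩ := Tree.choice_inj hU
      subst h1
      rw [Finset.mem_singleton] at ha
      subst ha
      exact ⟨rfl, (h2 _ (Finset.mem_singleton_self _)).symm⟩
  · rintro ⟨rfl, rfl⟩
    exact .sync _ _ _ _ _ (Finset.mem_singleton_self _)

theorem trans_inp_send {a b : Tag} {S T : Tree} :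
    Trans .inp a (Tree.send b S) T ↔ ∃ S', Trans .inp a S S' ∧ T = Tree.send b S' := by
  rw [trans_iff]
  constructor
  · intro h
    generalize hU : Tree.send b S = U at h
    cases h with
    | sync p I h k a ha => cases (Tree.choice_inj hU).1
    | async I h k k' a hR =>
      obtain ⟨-, h1, h2⟩ := Tree.choice_inj hU
      subst h1
      have hb := Finset.mem_singleton_self b
      refine ⟨k' b, h2 b hb ▸ hR b hb, Tree.choice_congr fun c hc => ?_⟩
      rw [Finset.mem_singleton.1 hc]
  · rintro ⟨S', h, rfl⟩
    exact .async _ _ _ _ _ fun _ _ => h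

theorem not_trans_done {p : Polarity} {a : Tag} {T : Tree} : ¬ Trans p a Tree.done T := by
  rw [trans_iff]
  intro h
  generalize hU : Tree.done = U at h
  cases h <;> exact Tree.choice_ne_done hU.symm

theorem not_trans_out_choice_inp {a : Tag} {I : Finset Tag} {h : I.Nonempty} {k : Tag → Tree}
    {T : Tree} : ¬ Trans .out a (Tree.choice .inp I h k) T := by
  rw [trans_iff]
  intro h
  generalize hU : Tree.choice _ _ _ _ = U at h
  cases h
  cases (Tree.choice_inj hU).1

theorem trans_inp_choice_inp {a : Tag} {I : Finset Tag} {h : I.Nonempty} {k : Tag → Tree}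
    {T : Tree} : Trans .inp a (Tree.choice .inp I h k) T ↔ a ∈ I ∧ T = k a := by
  rw [trans_iff]
  constructor
  · intro h
    generalize hU : Tree.choice _ _ _ _ = U at h
    cases h with
    | sync p I h k a ha =>
      obtain ⟨-, h1, h2⟩ := Tree.choice_inj hU
      subst h1
      exact ⟨ha, (h2 a ha).symm⟩
    | async I h k k' a hR => cases (Tree.choice_inj hU).1
  · rintro ⟨ha, rfl⟩
    exact .sync _ _ _ _ _ ha

theorem Child.exists_eq {S T : Tree} (H : Child S T) :
    ∃ p I, ∃ h : I.Nonempty, ∃ k : Tag → Tree, ∃ a ∈ I, S = Tree.choice p I h k ∧ T = k a := by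
  cases H with
  | mk p I h k a ha => exact ⟨p, I, h, k, a, ha, rfl, rfl⟩

theorem child_send (a : Tag) (S : Tree) : Child (Tree.send a S) S :=
  Child.mk .out {a} _ (fun _ => S) a (Finset.mem_singleton_self a)

theorem reaches_sendAll (w : List Tag) (S : Tree) :
    ReflTransGen Child (Tree.sendAll w S) S := by
  induction w with
  | nil => exact .refl
  | cons a w ih => exact .head (child_send a _) ih

@[simp] theorem Tree.sendAll_nil (S : Tree) : Tree.sendAll [] S = S := rfl

theorem Tree.sendAll_cons (a : Tag) (w : List Tag) (S : Tree) :
    Tree.sendAll (a :: w) S = Tree.choice .out {a} (Finset.singleton_nonempty a)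
      (fun _ => Tree.sendAll w S) := rfl

/-! ### Transducers -/

/-- The trees `t x` implement the transducer `act`: in the state `x`, the tag `a` is accepted if
`act x a = some (w, y)`, after which the tags of `w` are sent and the state is `y`; a state that
accepts no tags is implemented by `end`. -/
def Realizes {X : Type*} (act : X → Tag → Option (List Tag × X)) (t : X → Tree) : Prop :=
  ∀ x, (t x = Tree.done ∧ ∀ a, act x a = none) ∨
    ∃ I, ∃ h : I.Nonempty, ∃ k : Tag → Tree, t x = Tree.choice .inp I h k ∧
      ∀ a, (a ∈ I → ∃ w y, act x a = some (w, y) ∧ k a = Tree.sendAll w (t y)) ∧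
        (a ∉ I → act x a = none)

namespace Realizes

variable {X : Type*} {act : X → Tag → Option (List Tag × X)} {t : X → Tree}

theorem sendAll_eq_done {w : List Tag} {x : X} :
    Tree.sendAll w (t x) = Tree.done ↔ w = [] ∧ t x = Tree.done := by
  cases w with
  | nil => simp
  | cons a w => simpa [Tree.sendAll_cons] using Tree.choice_ne_done

theorem sendAll_eq_choice_inp (H : Realizes act t) {w : List Tag} {x : X} {I : Finset Tag}
    {h : I.Nonempty} {k : Tag → Tree} (he : Tree.sendAll w (t x) = Tree.choice .inp I h k) :
    w = [] ∧ ∀ a ∈ I, ∃ z y, act x a = some (z, y) ∧ k a = Tree.sendAll z (t y) := by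
  cases w with
  | cons a w =>
    rw [Tree.sendAll_cons] at he
    cases (Tree.choice_inj he).1
  | nil =>
    refine ⟨rfl, fun a ha => ?_⟩
    obtain ⟨h1, -⟩ | ⟨J, h', l, h1, h2⟩ := H x
    · exact absurd (he.symm.trans h1) Tree.choice_ne_done
    · obtain ⟨-, rfl, h3⟩ := Tree.choice_inj (he.symm.trans h1)
      rw [h3 a ha]
      exact (h2 a).1 ha

theorem sendAll_eq_choice_out (H : Realizes act t) {w : List Tag} {x : X} {I : Finset Tag}
    {h : I.Nonempty} {k : Tag → Tree} (he : Tree.sendAll w (t x) = Tree.choice .out I h k) :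
    ∃ b z, w = b :: z ∧ I = {b} ∧ k b = Tree.sendAll z (t x) := by
  cases w with
  | cons a w =>
    rw [Tree.sendAll_cons] at he
    obtain ⟨-, h1, h2⟩ := Tree.choice_inj he
    exact ⟨a, w, rfl, h1.symm, (h2 a (Finset.mem_singleton_self a)).symm⟩
  | nil =>
    obtain ⟨h1, -⟩ | ⟨J, h', l, h1, h2⟩ := H x
    · exact absurd (he.symm.trans h1) Tree.choice_ne_done
    · cases (Tree.choice_inj (he.symm.trans h1)).1

theorem eq_choice_inp (H : Realizes act t) {x y : X} {a : Tag} {w : List Tag}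
    (ha : act x a = some (w, y)) :
    ∃ I, ∃ h : I.Nonempty, ∃ k : Tag → Tree, t x = Tree.choice .inp I h k ∧ a ∈ I ∧
      k a = Tree.sendAll w (t y) := by
  obtain ⟨-, h1⟩ | ⟨I, h, k, h1, h2⟩ := H x
  · simp [h1 a] at ha
  · by_cases haI : a ∈ I
    · obtain ⟨w', y', h3, h4⟩ := (h2 a).1 haI
      rw [ha] at h3
      cases h3
      exact ⟨I, h, k, h1, haI, h4⟩
    · simp [(h2 a).2 haI] at ha

theorem trans_out_iff (H : Realizes act t) {w : List Tag} {x : X} {a : Tag} {T : Tree} :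
    Trans .out a (Tree.sendAll w (t x)) T ↔ ∃ z, w = a :: z ∧ T = Tree.sendAll z (t x) := by
  cases w with
  | nil =>
    refine ⟨fun h => ?_, by simp⟩
    obtain ⟨h1, -⟩ | ⟨J, h', l, h1, -⟩ := H x
    · exact absurd (h1 ▸ h) not_trans_done
    · exact absurd (h1 ▸ h) not_trans_out_choice_inp
  | cons b w =>
    refine trans_out_send.trans ?_
    simp only [List.cons.injEq]
    constructor
    · rintro ⟨rfl, rfl⟩
      exact ⟨w, ⟨rfl, rfl⟩, rfl⟩
    · rintro ⟨z, ⟨rfl, rfl⟩, rfl⟩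
      exact ⟨rfl, rfl⟩

/-- The rule `async` pushes the input through the prefix `w` one output at a time, and the answer
`z` is then sent after `w`. So the outputs of a component behave like a queue to which answers are
appended. -/
theorem trans_inp_iff (H : Realizes act t) {w : List Tag} {x : X} {a : Tag} {T : Tree} :
    Trans .inp a (Tree.sendAll w (t x)) T ↔
      ∃ z y, act x a = some (z, y) ∧ T = Tree.sendAll (w ++ z) (t y) := by
  induction w generalizing T with
  | nil =>
    constructor
    · intro h
      obtain ⟨h1, -⟩ | ⟨J, h', l, h1, h2⟩ := H x
      · exact absurd (h1 ▸ h) not_trans_done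
      · obtain ⟨ha, rfl⟩ := trans_inp_choice_inp.1 (h1 ▸ h)
        exact (h2 a).1 ha
    · rintro ⟨z, y, h, rfl⟩
      obtain ⟨I, h', k, h1, h2, h3⟩ := H.eq_choice_inp h
      exact (show t x = _ from h1) ▸ trans_inp_choice_inp.2 ⟨h2, h3.symm⟩
  | cons b w ih =>
    refine trans_inp_send.trans ⟨?_, ?_⟩
    · rintro ⟨S', h, rfl⟩
      obtain ⟨z, y, h1, rfl⟩ := ih.1 h
      exact ⟨z, y, h1, rfl⟩
    · rintro ⟨z, y, h1, rfl⟩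
      exact ⟨_, ih.2 ⟨z, y, h1, rfl⟩, rfl⟩

theorem mem_outTags (H : Realizes act t) {w : List Tag} {x : X} {a : Tag} :
    a ∈ outTags (Tree.sendAll w (t x)) ↔ w.head? = some a := by
  simp only [outTags, Set.mem_ofPred_eq, H.trans_out_iff]
  cases w <;> simp

theorem mem_inpTags (H : Realizes act t) {w : List Tag} {x : X} {a : Tag} :
    a ∈ inpTags (Tree.sendAll w (t x)) ↔ (act x a).isSome := by
  simp only [inpTags, Set.mem_ofPred_eq, H.trans_inp_iff]
  constructor
  · rintro ⟨_, z, y, h, -⟩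
    simp [h]
  · intro h
    obtain ⟨⟨z, y⟩, h⟩ := Option.isSome_iff_exists.1 h
    exact ⟨_, z, y, h, rfl⟩

/-- If every state can reach `end`, then the trees of a transducer are session types. -/
theorem isSessionType (H : Realizes act t) (hd : ∀ x, ReflTransGen Child (t x) Tree.done)
    (w : List Tag) (x : X) : IsSessionType (Tree.sendAll w (t x)) := by
  intro T hT
  suffices h : ∃ w x, T = Tree.sendAll w (t x) by
    obtain ⟨w, x, rfl⟩ := h
    exact (reaches_sendAll w _).trans (hd x)
  induction hT with
  | refl => exact ⟨w, x, rfl⟩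
  | tail _ hc ih =>
    obtain ⟨w, x, rfl⟩ := ih
    obtain ⟨p, I, h, k, a, ha, h1, rfl⟩ := hc.exists_eq
    cases p with
    | inp =>
      obtain ⟨-, h2⟩ := H.sendAll_eq_choice_inp h1
      obtain ⟨z, y, -, h3⟩ := h2 a ha
      exact ⟨z, y, h3⟩
    | out =>
      obtain ⟨b, z, rfl, rfl, h2⟩ := H.sendAll_eq_choice_out h1
      rw [Finset.mem_singleton.1 ha]
      exact ⟨z, x, h2⟩

end Realizes

/-! ### Pairs of transducers connected by two queues -/

/-- Two transducers and the queues of the tags sent to each of them and not yet received. -/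
structure Ring (X Y : Type*) where
  left : X
  leftQueue : List Tag
  right : Y
  rightQueue : List Tag

section Ring

variable {X Y : Type*}

/-- One of the transducers receives a tag and sends its response. -/
inductive RingStep (α : X → Tag → Option (List Tag × X)) (β : Y → Tag → Option (List Tag × Y)) :
    Ring X Y → Ring X Y → Prop
  | left (x x' : X) (y : Y) (a : Tag) (l r w : List Tag) (h : α x a = some (w, x')) :
      RingStep α β ⟨x, a :: l, y, r⟩ ⟨x', l, y, r ++ w⟩
  | right (x : X) (y y' : Y) (a : Tag) (l r w : List Tag) (h : β y a = some (w, y')) :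
      RingStep α β ⟨x, l, y, a :: r⟩ ⟨x, l ++ w, y', r⟩

/-- Every reachable ring can reach one with empty queues and implemented by `end` and `end`. -/
def Ring.Correct (α : X → Tag → Option (List Tag × X)) (β : Y → Tag → Option (List Tag × Y))
    (s : X → Tree) (t : Y → Tree) (r₀ : Ring X Y) : Prop :=
  ∀ r, ReflTransGen (RingStep α β) r₀ r → ∃ x y, s x = Tree.done ∧ t y = Tree.done ∧
    ReflTransGen (RingStep α β) r ⟨x, [], y, []⟩

/-- The queues of the configuration `c` together with the pending outputs of its components are the
queues of the ring `r`. -/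
def Ring.Implements (s : X → Tree) (t : Y → Tree) (c : Config) (r : Ring X Y) : Prop :=
  ∃ w z, c.left = Tree.sendAll w (s r.left) ∧ c.right = Tree.sendAll z (t r.right) ∧
    r.leftQueue = c.leftQueue ++ z ∧ r.rightQueue = c.rightQueue ++ w

variable {α : X → Tag → Option (List Tag × X)} {β : Y → Tag → Option (List Tag × Y)}
  {s : X → Tree} {t : Y → Tree}

/-- Sending moves a tag from the pending outputs to the adjacent queue and leaves their
concatenation unchanged, so the ring does not move. Receiving is possible only without pending
outputs, and is then a step of the ring. -/
theorem Ring.Implements.ringStep (hs : Realizes α s) (ht : Realizes β t) {c c' : Config}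
    {r : Ring X Y} (hr : Ring.Implements s t c r) (hc : ConfigStep c c') :
    ∃ r', ReflTransGen (RingStep α β) r r' ∧ Ring.Implements s t c' r' := by
  obtain ⟨x, rl, y, rr⟩ := r
  obtain ⟨w, z, h1, h2, rfl, rfl⟩ := hr
  cases hc with
  | leftSend I h k a ha v T u =>
    obtain ⟨b, w', rfl, rfl, h3⟩ := hs.sendAll_eq_choice_out h1.symm
    rw [Finset.mem_singleton] at ha
    subst ha
    exact ⟨_, .refl, w', z, h3, h2, rfl, by simp⟩
  | rightSend I h k a ha S v u =>
    obtain ⟨b, z', rfl, rfl, h3⟩ := ht.sendAll_eq_choice_out h2.symm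
    rw [Finset.mem_singleton] at ha
    subst ha
    exact ⟨_, .refl, w, z', h1, h3, by simp, rfl⟩
  | leftReceive I h k a ha v T u =>
    obtain ⟨rfl, h3⟩ := hs.sendAll_eq_choice_inp h1.symm
    obtain ⟨w', x', h4, h5⟩ := h3 a ha
    exact ⟨_, .single (.left _ _ _ _ _ _ _ h4), w', z, h5, h2, rfl, by simp⟩
  | rightReceive I h k a ha S v u =>
    obtain ⟨rfl, h3⟩ := ht.sendAll_eq_choice_inp h2.symm
    obtain ⟨z', y', h4, h5⟩ := h3 a ha
    exact ⟨_, .single (.right _ _ _ _ _ _ _ h4), w, z', h1, h5, by simp, rfl⟩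

theorem reaches_leftSendAll (w : List Tag) (S : Tree) (l : List Tag) (T : Tree) (r : List Tag) :
    ReflTransGen ConfigStep ⟨Tree.sendAll w S, l, T, r⟩ ⟨S, l, T, r ++ w⟩ := by
  induction w generalizing r with
  | nil => simp [ReflTransGen.refl]
  | cons a w ih =>
    rw [Tree.sendAll_cons]
    refine .head (ConfigStep.leftSend {a} _ _ a (Finset.mem_singleton_self a) _ _ _) ?_
    simpa using ih (r ++ [a])

theorem reaches_rightSendAll (w : List Tag) (S : Tree) (l : List Tag) (T : Tree) (r : List Tag) :
    ReflTransGen ConfigStep ⟨S, l, Tree.sendAll w T, r⟩ ⟨S, l ++ w, T, r⟩ := by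
  induction w generalizing l with
  | nil => simp [ReflTransGen.refl]
  | cons a w ih =>
    rw [Tree.sendAll_cons]
    refine .head (ConfigStep.rightSend {a} _ _ a (Finset.mem_singleton_self a) _ _ _) ?_
    simpa using ih (l ++ [a])

/-- All pending outputs are flushed first; the queues then agree with those of the ring, and the
receiving component stands at its input choice. -/
theorem Ring.Implements.configStep (hs : Realizes α s) (ht : Realizes β t) {c : Config}
    {r r' : Ring X Y} (hr : Ring.Implements s t c r) (hc : RingStep α β r r') :
    ∃ c', ReflTransGen ConfigStep c c' ∧ Ring.Implements s t c' r' := by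
  obtain ⟨L, l, R, u⟩ := c
  obtain ⟨w, z, h1, h2, h3, h4⟩ := hr
  dsimp only at h1 h2 h3 h4
  subst h1 h2
  have hfl := (reaches_leftSendAll w (s r.left) l (Tree.sendAll z (t r.right)) u).trans
    (reaches_rightSendAll z _ l _ _)
  rw [← h3, ← h4] at hfl
  cases hc with
  | left x x' y a l r w h =>
    obtain ⟨I, h', k, h5, h6, h7⟩ := hs.eq_choice_inp h
    rw [show s (Ring.left ⟨x, a :: l, y, r⟩) = _ from h5] at hfl ⊢
    exact ⟨⟨k a, l, t y, r⟩, hfl.tail (.leftReceive I h' k a h6 _ _ _), w, [], h7, rfl, by simp, rfl⟩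
  | right x y y' a l r w h =>
    obtain ⟨I, h', k, h5, h6, h7⟩ := ht.eq_choice_inp h
    rw [show t (Ring.right ⟨x, l, y, a :: r⟩) = _ from h5] at hfl ⊢
    exact ⟨⟨s x, l, k a, r⟩, hfl.tail (.rightReceive I h' k a h6 _ _ _), [], w, rfl, h7, rfl, by simp⟩

theorem Ring.Implements.ringReaches (hs : Realizes α s) (ht : Realizes β t) {c c' : Config}
    {r : Ring X Y} (hr : Ring.Implements s t c r) (hc : ReflTransGen ConfigStep c c') :
    ∃ r', ReflTransGen (RingStep α β) r r' ∧ Ring.Implements s t c' r' := by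
  induction hc with
  | refl => exact ⟨r, .refl, hr⟩
  | tail _ h ih =>
    obtain ⟨r', h1, h2⟩ := ih
    obtain ⟨r'', h3, h4⟩ := h2.ringStep hs ht h
    exact ⟨r'', h1.trans h3, h4⟩

theorem Ring.Implements.configReaches (hs : Realizes α s) (ht : Realizes β t) {c : Config}
    {r r' : Ring X Y} (hr : Ring.Implements s t c r) (hc : ReflTransGen (RingStep α β) r r') :
    ∃ c', ReflTransGen ConfigStep c c' ∧ Ring.Implements s t c' r' := by
  induction hc with
  | refl => exact ⟨c, .refl, hr⟩
  | tail _ h ih =>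
    obtain ⟨r', h1, h2⟩ := ih
    obtain ⟨r'', h3, h4⟩ := h2.configStep hs ht h
    exact ⟨r'', h1.trans h3, h4⟩

/-- Compliance of two transducers, in terms of their ring. -/
theorem compliant_iff_ring (hs : Realizes α s) (ht : Realizes β t) (r₀ : Ring X Y) :
    Compliant (Tree.sendAll r₀.rightQueue (s r₀.left)) (Tree.sendAll r₀.leftQueue (t r₀.right)) ↔
      r₀.Correct α β s t := by
  have h₀ : Ring.Implements s t ⟨Tree.sendAll r₀.rightQueue (s r₀.left), [],
      Tree.sendAll r₀.leftQueue (t r₀.right), []⟩ r₀ := ⟨_, _, rfl, rfl, rfl, rfl⟩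
  constructor
  · intro H r hr
    obtain ⟨c, h1, h2⟩ := h₀.configReaches hs ht hr
    obtain ⟨⟨x, l, y, u⟩, h3, w, z, h4, h5, h6, h7⟩ := h2.ringReaches hs ht (H c h1)
    obtain ⟨rfl, h8⟩ := Realizes.sendAll_eq_done.1 h4.symm
    obtain ⟨rfl, h9⟩ := Realizes.sendAll_eq_done.1 h5.symm
    dsimp only [List.append_nil] at h6 h7
    subst h6 h7
    exact ⟨x, y, h8, h9, h3⟩
  · intro H c hc
    obtain ⟨r, h1, h2⟩ := h₀.ringReaches hs ht hc
    obtain ⟨x, y, hx, hy, h3⟩ := H r h1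
    obtain ⟨⟨S, l, T, u⟩, h4, w, z, h5, h6, h7, h8⟩ := h2.configReaches hs ht h3
    obtain ⟨h9, rfl⟩ := List.append_eq_nil_iff.1 h7.symm
    obtain ⟨h10, rfl⟩ := List.append_eq_nil_iff.1 h8.symm
    dsimp only at h5 h6 h9 h10
    rw [hx, Tree.sendAll_nil] at h5
    rw [hy, Tree.sendAll_nil] at h6
    subst h5 h6 h9 h10
    exact h4

/-- Each of the transducers accepts the first tag of its queue. -/
def Ring.Safe (α : X → Tag → Option (List Tag × X)) (β : Y → Tag → Option (List Tag × Y))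
    (r : Ring X Y) : Prop :=
  (∀ a, r.rightQueue.head? = some a → (β r.right a).isSome) ∧
    ∀ a, r.leftQueue.head? = some a → (α r.left a).isSome

/-- The session in which the queues of a ring are pending outputs. -/
def Ring.session (s : X → Tree) (t : Y → Tree) (r : Ring X Y) : Tree × Tree :=
  (Tree.sendAll r.rightQueue (s r.left), Tree.sendAll r.leftQueue (t r.right))

/-- The only possible output of a component is the head of its pending word, so the two inclusions
between outputs and inputs say exactly that the ring is safe. -/
theorem sessionStep_iff (hs : Realizes α s) (ht : Realizes β t) {r : Ring X Y}
    {d : Tree × Tree} :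
    SessionStep (r.session s t) d ↔
      r.Safe α β ∧ ∃ r', RingStep α β r r' ∧ d = r'.session s t := by
  obtain ⟨x, l, y, u⟩ := r
  obtain ⟨d1, d2⟩ := d
  rw [SessionStep, Ring.Safe, and_assoc]
  refine and_congr ?_ (and_congr ?_ ⟨?_, ?_⟩)
  · simp only [Set.subset_def, Ring.session, hs.mem_outTags, ht.mem_inpTags]
  · simp only [Set.subset_def, Ring.session, ht.mem_outTags, hs.mem_inpTags]
  · rintro ⟨p, a, h1, h2⟩
    cases p with
    | inp =>
      obtain ⟨z, x', h3, h4⟩ := hs.trans_inp_iff.1 h1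
      obtain ⟨l', h5, h6⟩ := ht.trans_out_iff.1 h2
      dsimp only at h3 h4 h5 h6
      subst h4 h5 h6
      exact ⟨_, .left _ _ _ _ _ _ _ h3, rfl⟩
    | out =>
      obtain ⟨z, y', h3, h4⟩ := ht.trans_inp_iff.1 h2
      obtain ⟨l', h5, h6⟩ := hs.trans_out_iff.1 h1
      dsimp only at h3 h4 h5 h6
      subst h4 h5 h6
      exact ⟨_, .right _ _ _ _ _ _ _ h3, rfl⟩
  · rintro ⟨r', h, h'⟩
    cases h'
    cases h with
    | left x x' y a l r w h =>
      exact ⟨.inp, a, hs.trans_inp_iff.2 ⟨w, x', h, rfl⟩, ht.trans_out_iff.2 ⟨l, rfl, rfl⟩⟩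
    | right x y y' a l r w h =>
      exact ⟨.out, a, hs.trans_out_iff.2 ⟨r, rfl, rfl⟩, ht.trans_inp_iff.2 ⟨w, y', h, rfl⟩⟩

/-- Correct composition of two transducers, in terms of their ring, if an invariant shows that no
transducer receives an unexpected tag. -/
theorem correctComposition_iff_ring (hs : Realizes α s) (ht : Realizes β t) {r₀ : Ring X Y}
    (P : Ring X Y → Prop) (h₀ : P r₀) (hP : ∀ r r', P r → RingStep α β r r' → P r')
    (hsafe : ∀ r, P r → r.Safe α β) :
    CorrectComposition (Tree.sendAll r₀.rightQueue (s r₀.left))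
      (Tree.sendAll r₀.leftQueue (t r₀.right)) ↔ r₀.Correct α β s t := by
  have to_session : ∀ r r', P r → ReflTransGen (RingStep α β) r r' → P r' ∧
      ReflTransGen SessionStep (r.session s t) (r'.session s t) := by
    intro r r' hr h
    induction h with
    | refl => exact ⟨hr, .refl⟩
    | tail _ h ih =>
      exact ⟨hP _ _ ih.1 h, ih.2.tail ((sessionStep_iff hs ht).2 ⟨hsafe _ ih.1, _, h, rfl⟩)⟩
  have to_ring : ∀ r d, ReflTransGen SessionStep (r.session s t) d →
      ∃ r', ReflTransGen (RingStep α β) r r' ∧ d = r'.session s t := by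
    intro r d h
    induction h with
    | refl => exact ⟨r, .refl, rfl⟩
    | tail _ h ih =>
      obtain ⟨r', h1, rfl⟩ := ih
      obtain ⟨-, r'', h2, rfl⟩ := (sessionStep_iff hs ht).1 h
      exact ⟨r'', h1.tail h2, rfl⟩
  constructor
  · intro H r hr
    obtain ⟨hPr, h1⟩ := to_session _ _ h₀ hr
    obtain ⟨⟨x, l, y, u⟩, h2, h3⟩ := to_ring _ _ (H _ h1)
    obtain ⟨h4, h5⟩ := Prod.mk.inj h3
    obtain ⟨h6, h8⟩ := Realizes.sendAll_eq_done.1 h4.symm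
    obtain ⟨h7, h9⟩ := Realizes.sendAll_eq_done.1 h5.symm
    dsimp only at h6 h7
    subst h6 h7
    exact ⟨x, y, h8, h9, h2⟩
  · intro H c hc
    obtain ⟨r, h1, rfl⟩ := to_ring _ _ hc
    obtain ⟨x, y, hx, hy, h3⟩ := H r h1
    have h4 := (to_session _ _ (to_session _ _ h₀ h1).1 h3).2
    have h5 : Ring.session s t ⟨x, [], y, []⟩ = (Tree.done, Tree.done) := Prod.ext hx hy
    rwa [h5] at h4

end Ring

end SessionTypes

namespace SessionTypes

open Relation

/-! ### Transducers given by equations -/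

section

variable {X : Type*}

/-- The transducer given by the equations of the unknowns without pending outputs. -/
def transducer (eqs : List Tag × X → Rhs (List Tag × X)) (x : X) (a : Tag) :
    Option (List Tag × X) :=
  match eqs ([], x) with
  | .fin => none
  | .choice _ I _ k => if a ∈ I then some (k a) else none

theorem realizes_transducer (eqs : List Tag × X → Rhs (List Tag × X))
    (hinp : ∀ x, eqs ([], x) = .fin ∨ ∃ I h k, eqs ([], x) = .choice .inp I h k)
    (hout : ∀ w x, solve eqs (w, x) = Tree.sendAll w (solve eqs ([], x))) :
    Realizes (transducer eqs) fun x => solve eqs ([], x) := by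
  intro x
  obtain hx | ⟨I, h, k, hx⟩ := hinp x
  · exact .inl ⟨solve_fin _ _ hx, fun a => by simp [transducer, hx]⟩
  · refine .inr ⟨I, h, _, solve_choice _ _ _ _ _ _ hx, fun a => ⟨fun ha => ?_, fun ha => ?_⟩⟩
    · exact ⟨(k a).1, (k a).2, by simp [transducer, hx, ha], hout _ _⟩
    · simp [transducer, hx, ha]

theorem Realizes.reaches {act : X → Tag → Option (List Tag × X)} {t : X → Tree}
    (H : Realizes act t) {x y : X} {a : Tag} {w : List Tag} (h : act x a = some (w, y)) :
    ReflTransGen Child (t x) (t y) := by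
  obtain ⟨I, h', k, h1, h2, h3⟩ := H.eq_choice_inp h
  have h4 := Child.mk .inp I h' k a h2
  rw [← h1, h3] at h4
  exact .head h4 (reaches_sendAll w _)

/-- The shape of the queues is expressed by equations, so that a step can be analysed when the
queues are given as concatenations. -/
theorem ringStep_iff {Y : Type*} {α : X → Tag → Option (List Tag × X)}
    {β : Y → Tag → Option (List Tag × Y)} {r r' : Ring X Y} :
    RingStep α β r r' ↔
      (∃ a l w x, r.leftQueue = a :: l ∧ α r.left a = some (w, x) ∧
        r' = ⟨x, l, r.right, r.rightQueue ++ w⟩) ∨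
      (∃ a u w y, r.rightQueue = a :: u ∧ β r.right a = some (w, y) ∧
        r' = ⟨r.left, r.leftQueue ++ w, y, u⟩) := by
  constructor
  · rintro (⟨x, x', y, a, l, r, w, h⟩ | ⟨x, y, y', a, l, r, w, h⟩)
    · exact .inl ⟨a, l, w, x', rfl, h, rfl⟩
    · exact .inr ⟨a, r, w, y', rfl, h, rfl⟩
  · obtain ⟨x, l, y, u⟩ := r
    rintro (⟨a, l, w, x', rfl, h, rfl⟩ | ⟨a, u, w, y', rfl, h, rfl⟩)
    · exact .left _ _ _ _ _ _ _ h
    · exact .right _ _ _ _ _ _ _ h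

end

/-! ### The machine and the forwarder as transducers -/

section Encoding

variable {Q Γ : Type*} [Fintype Q] [Fintype Γ] (M : QueueMachine Q Γ) (e : Γ ↪ Tag) (E E' : Tag)

theorem realizes_machine :
    Realizes (transducer (machineEqs M e E E')) fun s => solve (machineEqs M e E E') ([], s) :=
  realizes_transducer _ (fun s => by cases s with
    | none => exact .inl rfl
    | some p => exact .inr ⟨_, _, _, rfl⟩) (solve_machineEqs M e E E')

theorem realizes_forwarder :
    Realizes (transducer (forwarderEqs e E E')) fun s => solve (forwarderEqs e E E') ([], s) :=
  realizes_transducer _ (fun s => by cases s with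
    | main => exact .inr ⟨_, _, _, rfl⟩
    | seen => exact .inr ⟨_, _, _, rfl⟩
    | halt => exact .inl rfl) (solve_forwarderEqs e E E')

theorem machine_marker (p : Q) :
    transducer (machineEqs M e E E') (some p) E = some ([E], some p) := by
  simp [transducer, machineEqs, machineTags]

variable {E E'}

theorem machine_last (hEE' : E ≠ E') (p : Q) :
    transducer (machineEqs M e E E') (some p) E' = some ([], none) := by
  simp [transducer, machineEqs, machineTags, hEE'.symm]

variable {e}

theorem machine_symbol (hE : E ∉ Set.range e) (hE' : E' ∉ Set.range e) (p : Q) (A : Γ) :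
    transducer (machineEqs M e E E') (some p) (e A) =
      some ((M.δ p A).2.map e, some (M.δ p A).1) := by
  have h1 : e A ≠ E := fun h => hE ⟨A, h⟩
  have h2 : e A ≠ E' := fun h => hE' ⟨A, h⟩
  simp [transducer, machineEqs, machineTags, h1, h2, Function.partialInv_left e.injective A]

theorem forwarder_symbol (hE : E ∉ Set.range e) {y : ForwarderState} (hy : y ≠ .halt) (A : Γ) :
    transducer (forwarderEqs e E E') y (e A) = some ([e A], .main) := by
  have h1 : e A ≠ E := fun h => hE ⟨A, h⟩
  cases y with
  | halt => exact absurd rfl hy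
  | main => simp [transducer, forwarderEqs, forwarderTags, h1]
  | seen => simp [transducer, forwarderEqs, forwarderTags, h1]

variable (e E E')

theorem forwarder_main_marker :
    transducer (forwarderEqs e E E') .main E = some ([E], .seen) := by
  simp [transducer, forwarderEqs, forwarderTags]

theorem forwarder_seen_marker :
    transducer (forwarderEqs e E E') .seen E = some ([E'], .halt) := by
  simp [transducer, forwarderEqs, forwarderTags]

theorem machine_reaches_done (hEE' : E ≠ E') (s : Option Q) :
    ReflTransGen Child (solve (machineEqs M e E E') ([], s)) Tree.done := by
  have h0 : solve (machineEqs M e E E') ([], none) = Tree.done := solve_fin _ _ rfl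
  cases s with
  | none => rw [h0]
  | some p =>
    rw [← h0]
    exact (realizes_machine M e E E').reaches (machine_last M e hEE' p)

theorem forwarder_reaches_done (y : ForwarderState) :
    ReflTransGen Child (solve (forwarderEqs e E E') ([], y)) Tree.done := by
  have H := realizes_forwarder e E E'
  have h0 : solve (forwarderEqs e E E') ([], .halt) = Tree.done := solve_fin _ _ rfl
  rw [← h0]
  have h1 := H.reaches (forwarder_seen_marker e E E')
  cases y with
  | main => exact (H.reaches (forwarder_main_marker e E E')).trans h1
  | seen => exact h1
  | halt => exact .refl

theorem isSessionType_machineType (hEE' : E ≠ E') (p : Q) :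
    IsSessionType (machineType M e E E' p) :=
  (realizes_machine M e E E').isSessionType (machine_reaches_done M e E E' hEE') [] (some p)

theorem isSessionType_forwarderType (x : List Γ) :
    IsSessionType (forwarderType M e E E' x) :=
  (realizes_forwarder e E E').isSessionType (forwarder_reaches_done e E E') _ _

/-! ### Rings as configurations of the queue machine -/

/-- The ring encodes a configuration of the queue machine: the queue of the machine, starting with
the symbols on their way to the machine, is interrupted by exactly one marker. -/
inductive Encodes : Ring (Option Q) ForwarderState → Q × List Γ → Prop
  | left (p : Q) (y : ForwarderState) (l₁ l₂ u : List Γ) (hy : y = .main ∨ y = .seen ∧ l₂ = []) :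
      Encodes ⟨some p, l₁.map e ++ E :: l₂.map e, y, u.map e⟩ (p, l₁ ++ l₂ ++ u)
  | right (p : Q) (y : ForwarderState) (l u₁ u₂ : List Γ)
      (hy : y = .main ∨ y = .seen ∧ l = [] ∧ u₂ = []) :
      Encodes ⟨some p, l.map e, y, u₁.map e ++ E :: u₂.map e⟩ (p, l ++ u₁ ++ u₂)
  | last (p : Q) : Encodes ⟨some p, [E'], .halt, []⟩ (p, [])
  | halt (p : Q) : Encodes ⟨none, [], .halt, []⟩ (p, [])

variable {M e E E'}

set_option linter.unusedSectionVars false in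
-- All the other forms of an encoding ring contain a marker `E` or `E'` in one of the queues.
theorem Encodes.nil_of_empty {x : Option Q} {y : ForwarderState} {c : Q × List Γ}
    (h : Encodes e E E' ⟨x, [], y, []⟩ c) : c.2 = [] := by
  generalize hr : (⟨x, [], y, []⟩ : Ring (Option Q) ForwarderState) = r at h
  cases h <;> simp at hr ⊢

/-- Only the machine's reading of a symbol is a step of `M`. Forwarding a symbol or moving a marker
changes the way the queue is cut into pieces, but not the queue itself. -/
theorem Encodes.step (hE : E ∉ Set.range e) (hE' : E' ∉ Set.range e) (hEE' : E ≠ E')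
    {r r' : Ring (Option Q) ForwarderState} {c : Q × List Γ} (h : Encodes e E E' r c)
    (hr : RingStep (transducer (machineEqs M e E E')) (transducer (forwarderEqs e E E')) r r') :
    ∃ c', ReflTransGen M.Step c c' ∧ Encodes e E E' r' c' := by
  rw [ringStep_iff] at hr
  cases h with
  | left p y l₁ l₂ u hy =>
    have hy0 : y ≠ .halt := by rintro rfl; simp at hy
    obtain ⟨a, l, w, x, h1, h2, rfl⟩ | ⟨a, u', w, y', h1, h2, rfl⟩ := hr
    · cases l₁ with
      | nil =>
        obtain ⟨rfl, rfl⟩ := List.cons.inj h1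
        rw [machine_marker] at h2
        cases h2
        refine ⟨_, .refl, ?_⟩
        have := Encodes.right (e := e) (E := E) (E' := E') p y l₂ u [] (by simpa using hy)
        simpa using this
      | cons A l₁ =>
        obtain ⟨rfl, rfl⟩ := List.cons.inj h1
        rw [machine_symbol M hE hE'] at h2
        cases h2
        refine ⟨_, .single (.mk p A (l₁ ++ l₂ ++ u)), ?_⟩
        have := Encodes.left (e := e) (E := E) (E' := E') (M.δ p A).1 y l₁ l₂ (u ++ (M.δ p A).2) hy
        simpa using this
    · cases u with
      | nil => cases h1
      | cons A u =>
        obtain ⟨rfl, rfl⟩ := List.cons.inj h1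
        rw [forwarder_symbol hE hy0] at h2
        cases h2
        refine ⟨_, .refl, ?_⟩
        have := Encodes.left (e := e) (E := E) (E' := E') p .main l₁ (l₂ ++ [A]) u (.inl rfl)
        simpa using this
  | right p y l u₁ u₂ hy =>
    have hy0 : y ≠ .halt := by rintro rfl; simp at hy
    obtain ⟨a, l', w, x, h1, h2, rfl⟩ | ⟨a, u', w, y', h1, h2, rfl⟩ := hr
    · cases l with
      | nil => cases h1
      | cons A l =>
        obtain ⟨rfl, rfl⟩ := List.cons.inj h1
        rw [machine_symbol M hE hE'] at h2
        cases h2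
        refine ⟨_, .single (.mk p A (l ++ u₁ ++ u₂)), ?_⟩
        -- In the state `seen` there would be no symbol on the left; so the state is `main`, and the
        -- answer may be placed behind the marker.
        have := Encodes.right (e := e) (E := E) (E' := E') (M.δ p A).1 y l u₁ (u₂ ++ (M.δ p A).2)
          (.inl (by simpa using hy))
        simpa using this
    · cases u₁ with
      | nil =>
        obtain ⟨rfl, rfl⟩ := List.cons.inj h1
        -- The marker reaches the forwarder. In the state `seen` the invariant now leaves no symbol
        -- anywhere, which justifies sending `E'`.
        obtain rfl | ⟨rfl, rfl, rfl⟩ := hy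
        · rw [forwarder_main_marker] at h2
          cases h2
          refine ⟨_, .refl, ?_⟩
          have := Encodes.left (e := e) (E := E) (E' := E') p .seen l [] u₂ (.inr ⟨rfl, rfl⟩)
          simpa using this
        · rw [forwarder_seen_marker] at h2
          cases h2
          exact ⟨_, .refl, .last p⟩
      | cons A u₁ =>
        obtain ⟨rfl, rfl⟩ := List.cons.inj h1
        rw [forwarder_symbol hE hy0] at h2
        cases h2
        refine ⟨_, .refl, ?_⟩
        have := Encodes.right (e := e) (E := E) (E' := E') p .main (l ++ [A]) u₁ u₂ (.inl rfl)
        simpa using this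
  | last p =>
    obtain ⟨a, l, w, x, h1, h2, rfl⟩ | ⟨a, u', w, y', h1, h2, rfl⟩ := hr
    · obtain ⟨rfl, rfl⟩ := List.cons.inj h1
      rw [machine_last M e hEE'] at h2
      cases h2
      exact ⟨_, .refl, .halt p⟩
    · cases h1
  | halt p =>
    obtain ⟨a, l, w, x, h1, h2, rfl⟩ | ⟨a, u', w, y', h1, h2, rfl⟩ := hr <;> cases h1

theorem Encodes.safe (hE : E ∉ Set.range e) (hE' : E' ∉ Set.range e) (hEE' : E ≠ E')
    {r : Ring (Option Q) ForwarderState} {c : Q × List Γ} (h : Encodes e E E' r c) :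
    r.Safe (transducer (machineEqs M e E E')) (transducer (forwarderEqs e E E')) := by
  cases h with
  | left p y l₁ l₂ u hy =>
    have hy0 : y ≠ .halt := by rintro rfl; simp at hy
    constructor
    · cases u <;> simp [forwarder_symbol hE hy0]
    · cases l₁ <;> simp [machine_symbol M hE hE', machine_marker]
  | right p y l u₁ u₂ hy =>
    have hy0 : y ≠ .halt := by rintro rfl; simp at hy
    constructor
    · cases u₁ with
      | nil => obtain rfl | ⟨rfl, -⟩ := hy <;> simp [forwarder_main_marker, forwarder_seen_marker]
      | cons A u => simp [forwarder_symbol hE hy0]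
    · cases l <;> simp [machine_symbol M hE hE']
  | last p => simp [Ring.Safe, machine_last M e hEE']
  | halt p => simp [Ring.Safe]

/-- The first symbol of the queue of `M` is still at the forwarder: it is forwarded and at once
consumed by the machine. -/
theorem Encodes.progress_of_left_empty (hE : E ∉ Set.range e) (hE' : E' ∉ Set.range e) (p : Q)
    {y : ForwarderState} (hy : y ≠ .halt) (A : Γ) (u₁ u₂ : List Γ) :
    ∃ r', ReflTransGen
        (RingStep (transducer (machineEqs M e E E')) (transducer (forwarderEqs e E E')))
        ⟨some p, [], y, (A :: u₁).map e ++ E :: u₂.map e⟩ r' ∧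
      Encodes e E E' r' ((M.δ p A).1, u₁ ++ u₂ ++ (M.δ p A).2) := by
  refine ⟨_, (ReflTransGen.single
    (.right _ _ _ _ _ _ _ (forwarder_symbol hE hy A))).tail
    (.left _ _ _ _ _ _ _ (machine_symbol M hE hE' p A)), ?_⟩
  have := Encodes.right (e := e) (E := E) (E' := E') (M.δ p A).1 .main [] u₁ (u₂ ++ (M.δ p A).2)
    (.inl rfl)
  simpa using this

/-- The first symbol is brought to the machine, after moving the marker out of its way if necessary.
The marker cannot trigger `E'` meanwhile, because a symbol remains. -/
theorem Encodes.progress (hE : E ∉ Set.range e) (hE' : E' ∉ Set.range e)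
    {r : Ring (Option Q) ForwarderState} {p : Q} {A : Γ} {w : List Γ}
    (h : Encodes e E E' r (p, A :: w)) :
    ∃ r', ReflTransGen
        (RingStep (transducer (machineEqs M e E E')) (transducer (forwarderEqs e E E'))) r r' ∧
      Encodes e E E' r' ((M.δ p A).1, w ++ (M.δ p A).2) := by
  generalize hc : (p, A :: w) = c at h
  cases h with
  | left p' y l₁ l₂ u hy =>
    obtain ⟨rfl, hw⟩ := Prod.mk.inj hc
    have hy0 : y ≠ .halt := by rintro rfl; simp at hy
    cases l₁ with
    | cons B l₁ =>
      obtain ⟨rfl, rfl⟩ := List.cons.inj hw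
      refine ⟨_, .single (.left _ _ _ _ _ _ _ (machine_symbol M hE hE' p A)), ?_⟩
      have := Encodes.left (e := e) (E := E) (E' := E') (M.δ p A).1 y l₁ l₂ (u ++ (M.δ p A).2) hy
      simpa using this
    | nil =>
      have h1 : RingStep (transducer (machineEqs M e E E')) (transducer (forwarderEqs e E E'))
        ⟨some p, E :: l₂.map e, y, u.map e⟩ _ := .left _ _ _ _ _ _ _ (machine_marker M e E E' p)
      cases l₂ with
      | cons B l₂ =>
        obtain ⟨rfl, rfl⟩ := List.cons.inj hw
        obtain rfl | ⟨-, h⟩ := hy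
        · refine ⟨_, (ReflTransGen.single h1).tail
            (.left _ _ _ _ _ _ _ (machine_symbol M hE hE' p A)), ?_⟩
          have := Encodes.right (e := e) (E := E) (E' := E') (M.δ p A).1 .main l₂ u (M.δ p A).2
            (.inl rfl)
          simpa using this
        · cases h
      | nil =>
        cases u with
        | nil => cases hw
        | cons B u =>
          obtain ⟨rfl, rfl⟩ := List.cons.inj hw
          obtain ⟨r', h2, h3⟩ := progress_of_left_empty (M := M) hE hE' p hy0 A w []
          exact ⟨r', .head h1 h2, by simpa using h3⟩
  | right p' y l u₁ u₂ hy =>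
    obtain ⟨rfl, hw⟩ := Prod.mk.inj hc
    have hy0 : y ≠ .halt := by rintro rfl; simp at hy
    cases l with
    | cons B l =>
      obtain ⟨rfl, rfl⟩ := List.cons.inj hw
      refine ⟨_, .single (.left _ _ _ _ _ _ _ (machine_symbol M hE hE' p A)), ?_⟩
      have := Encodes.right (e := e) (E := E) (E' := E') (M.δ p A).1 y l u₁ (u₂ ++ (M.δ p A).2)
        (.inl (by simpa using hy))
      simpa using this
    | nil =>
      cases u₁ with
      | cons B u₁ =>
        obtain ⟨rfl, rfl⟩ := List.cons.inj hw
        exact progress_of_left_empty hE hE' p hy0 A u₁ u₂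
      | nil =>
        cases u₂ with
        | nil => cases hw
        | cons B u₂ =>
          obtain ⟨rfl, rfl⟩ := List.cons.inj hw
          obtain rfl | ⟨-, -, h⟩ := hy
          -- The marker precedes all the symbols at the forwarder. It makes one full turn and
          -- rejoins the right queue behind them, with the forwarder in the state `seen`.
          · obtain ⟨r', h2, h3⟩ := progress_of_left_empty (M := M) (E := E) (E' := E')
              (y := .seen) hE hE' p (by simp) A w []
            refine ⟨r', .head (.right _ _ _ _ _ _ _ (forwarder_main_marker e E E'))
              (.head (.left _ _ _ _ _ _ _ (machine_marker M e E E' p)) h2), by simpa using h3⟩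
          · cases h
  | last p => cases (Prod.mk.inj hc).2
  | halt p => cases (Prod.mk.inj hc).2

theorem Encodes.terminates (hEE' : E ≠ E')
    {r : Ring (Option Q) ForwarderState} {p : Q} (h : Encodes e E E' r (p, [])) :
    ReflTransGen (RingStep (transducer (machineEqs M e E E')) (transducer (forwarderEqs e E E')))
      r ⟨none, [], .halt, []⟩ := by
  -- With no symbols left only a marker circulates. From `h1` to `h5` the run is extended backwards
  -- by one step at a time, and each ring encoding an empty queue occurs on it.
  have h1 : ReflTransGen
      (RingStep (transducer (machineEqs M e E E')) (transducer (forwarderEqs e E E')))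
      ⟨some p, [E'], .halt, []⟩ ⟨none, [], .halt, []⟩ :=
    .single (.left _ _ _ _ _ _ _ (machine_last M e hEE' p))
  have h2 := ReflTransGen.head (.right _ _ _ _ [] [] _ (forwarder_seen_marker e E E')) h1
  have h3 := ReflTransGen.head (.left _ _ ForwarderState.seen _ [] [] _
    (machine_marker M e E E' p)) h2
  have h4 := ReflTransGen.head (.right _ _ _ _ [] [] _ (forwarder_main_marker e E E')) h3
  have h5 := ReflTransGen.head (.left _ _ ForwarderState.main _ [] [] _
    (machine_marker M e E E' p)) h4
  generalize hc : (p, []) = c at h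
  cases h with
  | left p' y l₁ l₂ u hy =>
    obtain ⟨rfl, hw⟩ := Prod.mk.inj hc
    obtain ⟨rfl, rfl, rfl⟩ : l₁ = [] ∧ l₂ = [] ∧ u = [] := by simpa using hw.symm
    obtain rfl | ⟨rfl, -⟩ := hy
    · exact h5
    · exact h3
  | right p' y l u₁ u₂ hy =>
    obtain ⟨rfl, hw⟩ := Prod.mk.inj hc
    obtain ⟨rfl, rfl, rfl⟩ : l = [] ∧ u₁ = [] ∧ u₂ = [] := by simpa using hw.symm
    obtain rfl | ⟨rfl, -⟩ := hy
    · exact h4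
    · exact h2
  | last p' =>
    cases hc
    exact h1
  | halt p' => exact .refl

/-! ### Acceptance as correctness of the initial ring -/

theorem step_rightUnique : Relator.RightUnique M.Step := by
  rintro _ _ _ ⟨p, A, w⟩ h
  cases h
  rfl

/-- The initial ring of the machine and the forwarder. -/
def initialRing (M : QueueMachine Q Γ) (e : Γ ↪ Tag) (E : Tag) (x : List Γ) :
    Ring (Option Q) ForwarderState :=
  ⟨some M.start, x.map e ++ [e M.dollar, E], .main, []⟩

theorem encodes_initialRing (x : List Γ) :
    Encodes e E E' (initialRing M e E x) (M.start, x ++ [M.dollar]) := by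
  have := Encodes.left (e := e) (E := E) (E' := E') M.start .main (x ++ [M.dollar]) [] []
    (.inl rfl)
  simpa [initialRing] using this

theorem Encodes.reaches (hE : E ∉ Set.range e) (hE' : E' ∉ Set.range e) (hEE' : E ≠ E')
    {r r' : Ring (Option Q) ForwarderState} {c : Q × List Γ} (h : Encodes e E E' r c)
    (hr : ReflTransGen
      (RingStep (transducer (machineEqs M e E E')) (transducer (forwarderEqs e E E'))) r r') :
    ∃ c', ReflTransGen M.Step c c' ∧ Encodes e E E' r' c' := by
  induction hr with
  | refl => exact ⟨c, .refl, h⟩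
  | tail _ hs ih =>
    obtain ⟨c', h1, h2⟩ := ih
    obtain ⟨c'', h3, h4⟩ := h2.step hE hE' hEE' hs
    exact ⟨c'', h1.trans h3, h4⟩

theorem Encodes.reaches_of_accepts (hE : E ∉ Set.range e) (hE' : E' ∉ Set.range e)
    (hEE' : E ≠ E') {c : Q × List Γ} {q : Q} (hc : ReflTransGen M.Step c (q, [])) :
    ∀ r : Ring (Option Q) ForwarderState, Encodes e E E' r c →
    ReflTransGen (RingStep (transducer (machineEqs M e E E')) (transducer (forwarderEqs e E E')))
      r ⟨none, [], .halt, []⟩ := by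
  induction hc using ReflTransGen.head_induction_on with
  | refl => exact fun r h => h.terminates hEE'
  | head hs _ ih =>
    intro r h
    obtain ⟨p, A, w⟩ := hs
    obtain ⟨r', h1, h2⟩ := h.progress (M := M) hE hE'
    exact h1.trans (ih r' h2)

theorem accepts_iff_ring (hE : E ∉ Set.range e) (hE' : E' ∉ Set.range e) (hEE' : E ≠ E')
    (x : List Γ) :
    M.Accepts x ↔ (initialRing M e E x).Correct (transducer (machineEqs M e E E'))
      (transducer (forwarderEqs e E E')) (fun s => solve (machineEqs M e E E') ([], s))
      (fun s => solve (forwarderEqs e E E') ([], s)) := by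
  have h₀ := encodes_initialRing (M := M) (e := e) (E := E) (E' := E') x
  constructor
  · rintro ⟨q, hq⟩ r hr
    obtain ⟨c, h1, h2⟩ := h₀.reaches hE hE' hEE' hr
    refine ⟨none, .halt, solve_fin _ _ rfl, solve_fin _ _ rfl, ?_⟩
    -- By determinism, `c` lies on the accepting run or after its end; the latter forces `c = (q,
    -- [])`, since an empty queue admits no step.
    obtain h3 | h3 := ReflTransGen.total_of_right_unique step_rightUnique h1 hq
    · exact h2.reaches_of_accepts hE hE' hEE' h3
    · obtain rfl | ⟨c', h4, -⟩ := ReflTransGen.cases_head h3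
      · exact h2.terminates hEE'
      · cases h4
  · intro H
    obtain ⟨s, y, -, -, h1⟩ := H _ .refl
    obtain ⟨⟨q, w⟩, h2, h3⟩ := h₀.reaches hE hE' hEE' h1
    obtain rfl : w = [] := h3.nil_of_empty
    exact ⟨q, h2⟩

theorem accepts_iff_correctComposition (hE : E ∉ Set.range e) (hE' : E' ∉ Set.range e)
    (hEE' : E ≠ E') (x : List Γ) :
    M.Accepts x ↔
      CorrectComposition (machineType M e E E' M.start) (forwarderType M e E E' x) := by
  rw [accepts_iff_ring hE hE' hEE']
  exact (correctComposition_iff_ring (realizes_machine M e E E') (realizes_forwarder e E E')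
    (fun r => ∃ c : Q × List Γ, Encodes e E E' r c) ⟨_, encodes_initialRing x⟩
    (fun r r' ⟨c, hc⟩ h => let ⟨c', _, h'⟩ := hc.step hE hE' hEE' h; ⟨c', h'⟩)
    (fun r ⟨c, hc⟩ => hc.safe hE hE' hEE')).symm

theorem accepts_iff_compliant (hE : E ∉ Set.range e) (hE' : E' ∉ Set.range e)
    (hEE' : E ≠ E') (x : List Γ) :
    M.Accepts x ↔ Compliant (machineType M e E E' M.start) (forwarderType M e E E' x) := by
  rw [accepts_iff_ring hE hE' hEE']
  exact (compliant_iff_ring (realizes_machine M e E E') (realizes_forwarder e E E')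
    (initialRing M e E x)).symm

end Encoding

end SessionTypes

namespace SessionTypes

open Relation Turing StateTransition

/-! ### Simulation of multi-stack machines by queue machines

A symbol `some (k, a)` of the queue alphabet is an entry of the stack `k`, the symbol `none` marks
the end of the queue. Entries of different stacks may be interleaved in any way; a statement of the
stack machine is simulated by one rotation of the queue. -/

section Simulation

variable {K G Λ σ : Type} [DecidableEq K]

/-- Control states of the simulation: `none` erases the queue, `some (true, q, v)` executes the
statement `q`, and `some (false, q, v)` first rotates the queue up to the end marker. -/
abbrev SimState (K G Λ σ : Type) : Type := Option (Bool × TM2.Stmt (fun _ : K => G) Λ σ × σ)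

/-- Transition function of the simulation. -/
def simStep (M : Λ → TM2.Stmt (fun _ : K => G) Λ σ) :
    SimState K G Λ σ → Option (K × G) → SimState K G Λ σ × List (Option (K × G))
  | none, _ => (none, [])
  | some (false, q, v), c => (some (c.isNone, q, v), [c])
  | some (true, .push k f q, v), c => (some (c.isNone, q, v), [some (k, f v), c])
  | some (true, .peek _ f q, v), none => (some (true, q, f v none), [none])
  | some (true, .peek k f q, v), some (j, a) =>
      (some (if j = k then (false, q, f v (some a)) else (true, .peek k f q, v)), [some (j, a)])
  | some (true, .pop _ f q, v), none => (some (true, q, f v none), [none])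
  | some (true, .pop k f q, v), some (j, a) =>
      if j = k then (some (false, q, f v (some a)), [])
      else (some (true, .pop k f q, v), [some (j, a)])
  | some (true, .load f q, v), c => (some (c.isNone, q, f v), [c])
  | some (true, .branch f q₁ q₂, v), c => (some (c.isNone, cond (f v) q₁ q₂, v), [c])
  | some (true, .goto l, v), c => (some (c.isNone, M (l v), v), [c])
  | some (true, .halt, _), _ => (none, [])

/-- One step of a queue machine with transition function `δ`. -/
def queueNext {Q Γ : Type} (δ : Q → Γ → Q × List Γ) : Q × List Γ → Option (Q × List Γ)
  | (_, []) => none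
  | (p, A :: w) => some ((δ p A).1, w ++ (δ p A).2)

/-- The entries of the stack `k`. -/
def stackOf (k : K) (w : List (K × G)) : List G :=
  w.filterMap fun p => if p.1 = k then some p.2 else none

/-- The queue whose entries are those of `w`. -/
def queueOf (w : List (K × G)) : List (Option (K × G)) := w.map some ++ [none]

variable (M : Λ → TM2.Stmt (fun _ : K => G) Λ σ)

theorem reaches_rotate (q : TM2.Stmt (fun _ : K => G) Λ σ) (v : σ) (w z : List (K × G)) :
    Reaches (queueNext (simStep M)) (some (false, q, v), w.map some ++ none :: z.map some)
      (some (true, q, v), queueOf (z ++ w)) := by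
  induction w generalizing z with
  | nil => exact .single (by simp [queueNext, simStep, queueOf])
  | cons a w ih =>
    refine .head (b := (some (false, q, v), w.map some ++ none :: (z ++ [a]).map some)) ?_ ?_
    · simp [queueNext, simStep]
    · simpa [Reaches] using ih (z ++ [a])

theorem reaches_erase (w : List (Option (K × G))) :
    Reaches (queueNext (simStep M)) (none, w) (none, []) := by
  induction w with
  | nil => exact .refl
  | cons a w ih => exact .head (b := (none, w)) (by simp [queueNext, simStep]) ih

/-- A statement that inspects no stack reads one symbol `c` and puts it back behind the new entries
`u`. If `c` is the end marker, the rotation is already complete; otherwise the flag `c.isNone`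
starts one. The rotation brings `u` to the front, so pushed entries are on top of their stack. -/
theorem reaches₁_of_prepend {p : SimState K G Λ σ} {q : TM2.Stmt (fun _ : K => G) Λ σ} {v : σ}
    {u : List (K × G)}
    (h : ∀ c, simStep M p c = (some (c.isNone, q, v), u.map some ++ [c])) (w : List (K × G)) :
    Reaches₁ (queueNext (simStep M)) (p, queueOf w) (some (true, q, v), queueOf (u ++ w)) := by
  cases w with
  | nil => exact .single (by simp [queueNext, queueOf, h])
  | cons a w =>
    refine .head' (b := (some (false, q, v), w.map some ++ none :: (u ++ [a]).map some)) ?_ ?_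
    · simp [queueNext, queueOf, h]
    · simpa [Reaches] using reaches_rotate M q v w (u ++ [a])

/-- The list `z` holds the entries already passed. The first entry of the stack `k` met is its top;
meeting the end marker first means that the stack is empty. -/
theorem reaches₁_peek (k : K) (f : σ → Option G → σ) (q : TM2.Stmt (fun _ : K => G) Λ σ) (v : σ)
    (w z : List (K × G)) :
    Reaches₁ (queueNext (simStep M))
      (some (true, .peek k f q, v), w.map some ++ none :: z.map some)
      (some (true, q, f v (stackOf k w).head?), queueOf (z ++ w)) := by
  induction w generalizing z with
  | nil => exact .single (by simp [queueNext, simStep, queueOf, stackOf])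
  | cons a w ih =>
    obtain ⟨j, a⟩ := a
    by_cases hj : j = k
    · refine .head' (b := (some (false, q, f v (some a)),
        w.map some ++ none :: (z ++ [(j, a)]).map some)) ?_ ?_
      · simp [queueNext, simStep, hj]
      · simpa [Reaches, stackOf, hj] using reaches_rotate M q (f v (some a)) w (z ++ [(j, a)])
    · refine .head (b := (some (true, .peek k f q, v),
        w.map some ++ none :: (z ++ [(j, a)]).map some)) ?_ ?_
      · simp [queueNext, simStep, hj]
      · simpa [Reaches₁, stackOf, hj] using ih (z ++ [(j, a)])

theorem reaches₁_pop (k : K) (f : σ → Option G → σ) (q : TM2.Stmt (fun _ : K => G) Λ σ) (v : σ)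
    (w z : List (K × G)) :
    Reaches₁ (queueNext (simStep M))
      (some (true, .pop k f q, v), w.map some ++ none :: z.map some)
      (some (true, q, f v (stackOf k w).head?), queueOf (z ++ w.eraseP fun p => p.1 = k)) := by
  induction w generalizing z with
  | nil => exact .single (by simp [queueNext, simStep, queueOf, stackOf])
  | cons a w ih =>
    obtain ⟨j, a⟩ := a
    by_cases hj : j = k
    · refine .head' (b := (some (false, q, f v (some a)), w.map some ++ none :: z.map some)) ?_ ?_
      · simp [queueNext, simStep, hj]
      · simpa [Reaches, stackOf, hj] using reaches_rotate M q (f v (some a)) w z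
    · refine .head (b := (some (true, .pop k f q, v),
        w.map some ++ none :: (z ++ [(j, a)]).map some)) ?_ ?_
      · simp [queueNext, simStep, hj]
      · simpa [Reaches₁, stackOf, hj] using ih (z ++ [(j, a)])

/-- The first entry labelled `k` is the top of the stack `k`, and deleting it affects no other
stack. -/
theorem stackOf_eraseP (k : K) (w : List (K × G)) :
    (fun j => stackOf j (w.eraseP fun p => p.1 = k)) =
      Function.update (fun j => stackOf j w) k (stackOf k w).tail := by
  funext j
  induction w with
  | nil =>
    by_cases hj : j = k
    · subst hj
      simp [stackOf]
    · simp [stackOf, hj]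
  | cons a w ih =>
    obtain ⟨i, a⟩ := a
    by_cases hj : j = k
    · subst hj
      rw [Function.update_self] at ih ⊢
      by_cases hi : i = j
      · simp [stackOf, hi]
      · simpa [stackOf, hi] using ih
    · rw [Function.update_of_ne hj] at ih ⊢
      by_cases hi : i = k
      · subst hi
        simp [stackOf, Ne.symm hj]
      · by_cases hij : i = j
        · simpa [stackOf, hi, hij, hj] using ih
        · simpa [stackOf, hi, hij] using ih

theorem stackOf_cons (k : K) (a : G) (w : List (K × G)) :
    (fun j => stackOf j ((k, a) :: w)) =
      Function.update (fun j => stackOf j w) k (a :: stackOf k w) := by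
  funext j
  by_cases hj : j = k
  · subst hj
    simp [stackOf]
  · simp [stackOf, hj, Ne.symm hj]

/-- A configuration of the stack machine is simulated by one of the queue machine; halting is
simulated by an empty queue. -/
def Simulates (c : TM2.Cfg (fun _ : K => G) Λ σ)
    (b : SimState K G Λ σ × List (Option (K × G))) : Prop :=
  match c.l with
  | some l => ∃ w, c.stk = (fun k => stackOf k w) ∧ b = (some (true, M l, c.var), queueOf w)
  | none => b.2 = []

/-- One step of the stack machine executes a whole statement, so the induction is on the statement,
with one rotation of the queue for each of its instructions. At `halt` the queue is erased instead,
because acceptance is by empty queue. -/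
theorem simulates_stepAux (q : TM2.Stmt (fun _ : K => G) Λ σ) (v : σ) (w : List (K × G)) :
    ∃ b, Simulates M (TM2.stepAux q v fun k => stackOf k w) b ∧
      Reaches₁ (queueNext (simStep M)) (some (true, q, v), queueOf w) b := by
  induction q generalizing v w with
  | push k f q ih =>
    obtain ⟨b, h1, h2⟩ := ih v ((k, f v) :: w)
    rw [stackOf_cons] at h1
    exact ⟨b, h1, (reaches₁_of_prepend M (u := [(k, f v)]) (fun c => rfl) w).trans h2⟩
  | peek k f q ih =>
    obtain ⟨b, h1, h2⟩ := ih (f v (stackOf k w).head?) w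
    exact ⟨b, h1, (reaches₁_peek M k f q v w []).trans h2⟩
  | pop k f q ih =>
    obtain ⟨b, h1, h2⟩ := ih (f v (stackOf k w).head?) (w.eraseP fun p => p.1 = k)
    rw [stackOf_eraseP] at h1
    exact ⟨b, h1, (reaches₁_pop M k f q v w []).trans h2⟩
  | load f q ih =>
    obtain ⟨b, h1, h2⟩ := ih (f v) w
    exact ⟨b, h1, (reaches₁_of_prepend M (u := []) (fun c => rfl) w).trans h2⟩
  | branch f q₁ q₂ ih₁ ih₂ =>
    have h := reaches₁_of_prepend M (p := some (true, .branch f q₁ q₂, v)) (u := [])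
      (fun c => rfl) w
    simp only [TM2.stepAux]
    cases hf : f v
    · obtain ⟨b, h1, h2⟩ := ih₂ v w
      rw [hf] at h
      exact ⟨b, h1, h.trans h2⟩
    · obtain ⟨b, h1, h2⟩ := ih₁ v w
      rw [hf] at h
      exact ⟨b, h1, h.trans h2⟩
  | goto l =>
    exact ⟨_, ⟨w, rfl, rfl⟩, reaches₁_of_prepend M (u := []) (fun c => rfl) w⟩
  | halt =>
    refine ⟨(none, []), rfl, ?_⟩
    cases w with
    | nil => exact .single (by simp [queueNext, simStep, queueOf])
    | cons a w =>
      exact .head' (b := (none, queueOf w)) (by simp [queueNext, simStep, queueOf])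
        (reaches_erase M _)

theorem respects_simulates :
    Respects (TM2.step M) (queueNext (simStep M)) (Simulates M) := by
  rintro ⟨l, v, S⟩ ⟨p, u⟩ h
  cases l with
  | none =>
    obtain rfl : u = [] := h
    rfl
  | some l =>
    obtain ⟨w, rfl, h2⟩ := h
    rw [h2]
    exact simulates_stepAux M (M l) v w

/-- The control states needed for the labels in `S`. -/
def simStates (S : Finset Λ) : Set (SimState K G Λ σ) :=
  {s | ∀ b q v, s = some (b, q, v) → some q ∈ TM2.stmts M S}

omit [DecidableEq K] in
-- A control state other than `none` consists of a flag, a substatement of the finitely many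
-- supported ones, and an element of the finite type `σ`.
theorem finite_simStates [Finite σ] (S : Finset Λ) : (simStates M S).Finite := by
  have h : ((Set.univ : Set Bool) ×ˢ ({q | some q ∈ TM2.stmts M S} ×ˢ (Set.univ : Set σ))).Finite :=
    Set.finite_univ.prod (Set.Finite.prod
      ((TM2.stmts M S).finite_toSet.preimage (Option.some_injective _).injOn) Set.finite_univ)
  refine ((h.image some).insert none).subset ?_
  rintro (_ | ⟨b, q, v⟩) hs
  · exact .inl rfl
  · exact .inr ⟨(b, q, v), ⟨trivial, hs b q v rfl, trivial⟩, rfl⟩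

theorem simStep_mem_simStates [Inhabited Λ] {S : Finset Λ} (hS : TM2.Supports M S)
    {s : SimState K G Λ σ} (hs : s ∈ simStates M S) (c : Option (K × G)) :
    (simStep M s c).1 ∈ simStates M S := by
  classical
  have key : ∀ b q v, some q ∈ TM2.stmts M S → some (b, q, v) ∈ simStates M S := by
    rintro b q v h _ _ _ h'
    cases h'
    exact h
  rcases s with _ | ⟨b, q, v⟩
  · exact hs
  have hq := hs b q v rfl
  cases b with
  | false => exact key _ _ _ hq
  | true =>
    have hsub : ∀ q', q' ∈ TM2.stmts₁ q → some q' ∈ TM2.stmts M S :=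
      fun q' h => TM2.stmts_trans h hq
    cases q with
    | push k f q => exact key _ _ _ (hsub q (by simp [TM2.stmts₁, TM2.stmts₁_self]))
    | peek k f q =>
      have h := hsub q (by simp [TM2.stmts₁, TM2.stmts₁_self])
      rcases c with _ | ⟨j, a⟩
      · exact key _ _ _ h
      · by_cases hj : j = k
        · simpa [simStep, hj] using key _ _ _ h
        · simpa [simStep, hj] using key _ _ _ hq
    | pop k f q =>
      have h := hsub q (by simp [TM2.stmts₁, TM2.stmts₁_self])
      rcases c with _ | ⟨j, a⟩
      · exact key _ _ _ h
      · by_cases hj : j = k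
        · simpa [simStep, hj] using key _ _ _ h
        · simpa [simStep, hj] using key _ _ _ hq
    | load f q => exact key _ _ _ (hsub q (by simp [TM2.stmts₁, TM2.stmts₁_self]))
    | branch f q₁ q₂ =>
      refine key _ _ _ (hsub _ ?_)
      cases f v <;> simp [TM2.stmts₁, TM2.stmts₁_self]
    | goto l =>
      refine key _ _ _ ?_
      have h : l v ∈ S := TM2.stmts_supportsStmt hS hq v
      simp only [TM2.stmts, Finset.some_mem_insertNone, Finset.mem_biUnion]
      exact ⟨l v, h, TM2.stmts₁_self⟩
    | halt => simp [simStep, simStates]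

/-- The queue machine that simulates a stack machine with finitely many labels. -/
noncomputable def simMachine [Inhabited Λ] {S : Finset Λ} (hS : TM2.Supports M S)
    [Fintype (simStates M S)] [Fintype (Option (K × G))] (v : σ) :
    QueueMachine (simStates M S) (Option (K × G)) where
  input := {A | A ≠ none}
  dollar := none
  dollar_notMem := by simp
  start := ⟨some (true, M default, v), by
    rintro _ _ _ h
    cases h
    simp only [TM2.stmts, Finset.some_mem_insertNone, Finset.mem_biUnion]
    exact ⟨default, hS.1, TM2.stmts₁_self⟩⟩
  δ p A := (⟨(simStep M p.1 A).1, simStep_mem_simStates M hS p.2 A⟩, (simStep M p.1 A).2)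

/-- `queueNext` is undefined exactly on empty queues, so acceptance is termination of `queueNext`,
which the simulation relates to halting of the stack machine. -/
theorem simMachine_accepts_iff [Inhabited Λ] {S : Finset Λ} (hS : TM2.Supports M S)
    [Fintype (simStates M S)] [Fintype (Option (K × G))] (v : σ) (w : List (K × G)) :
    (simMachine M hS v).Accepts (w.map some) ↔
      (StateTransition.eval (TM2.step M) ⟨some default, v, fun k => stackOf k w⟩).Dom := by
  have h₀ : Simulates M ⟨some default, v, fun k => stackOf k w⟩
      (some (true, M default, v), queueOf w) := ⟨w, rfl, rfl⟩
  rw [← tr_eval_dom (respects_simulates M) h₀]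
  have to_next : ∀ c d, (simMachine M hS v).Step c d →
      queueNext (simStep M) (c.1.1, c.2) = some (d.1.1, d.2) := by
    rintro _ _ ⟨p, A, z⟩
    rfl
  constructor
  · rintro ⟨q, hq⟩
    have h : Reaches (queueNext (simStep M)) (some (true, M default, v), queueOf w) (q.1, []) :=
      ReflTransGen.lift (fun c : simStates M S × List (Option (K × G)) => (c.1.1, c.2))
        to_next _ _ hq
    exact Part.dom_iff_mem.2 ⟨_, mem_eval.2 ⟨h, rfl⟩⟩
  · intro h
    obtain ⟨b, hb⟩ := Part.dom_iff_mem.1 h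
    obtain ⟨h1, h2⟩ := mem_eval.1 hb
    -- A run of `queueNext` from the start state never leaves the finite set of states, so it lifts
    -- to a run of the queue machine.
    have h3 : ∃ d, ReflTransGen (simMachine M hS v).Step
        ((simMachine M hS v).start, queueOf w) d ∧ b = (d.1.1, d.2) := by
      clear h2 hb
      induction h1 with
      | refl => exact ⟨_, .refl, rfl⟩
      | tail _ hs ih =>
        obtain ⟨⟨p, z⟩, h3, rfl⟩ := ih
        cases z with
        | nil => cases hs
        | cons A z =>
          obtain rfl := Option.some.inj hs
          exact ⟨_, h3.tail (.mk p A z), rfl⟩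
    obtain ⟨⟨p, z⟩, h4, rfl⟩ := h3
    cases z with
    | nil => exact ⟨p, h4⟩
    | cons A z => cases h2

end Simulation

/-! ### A queue machine with undecidable acceptance -/

/-- The halting problem for a fixed program of the basis `Turing.ToPartrec.Code`. -/
theorem exists_code_not_computablePred :
    ∃ u : ToPartrec.Code, ¬ ComputablePred fun n : ℕ => (u.eval [n]).Dom := by
  -- The program `u` is universal: it decodes its argument as a program and runs it on `0`.
  have hf : Partrec fun n : ℕ => Nat.Partrec.Code.eval (Denumerable.ofNat Nat.Partrec.Code n) 0 :=
    Nat.Partrec.Code.eval_part.comp (Computable.ofNat _) (Computable.const 0)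
  obtain ⟨u, hu⟩ := ToPartrec.Code.exists_code (Nat.Partrec'.part_iff₁.2 hf)
  refine ⟨u, fun h => ComputablePred.halting_problem 0 ?_⟩
  have h2 : ∀ c : Nat.Partrec.Code,
      (u.eval [Encodable.encode c]).Dom ↔ (Nat.Partrec.Code.eval c 0).Dom := by
    intro c
    have := hu ⟨[Encodable.encode c], rfl⟩
    simp only at this
    rw [this]
    simp [List.Vector.head]
  refine ComputablePred.of_eq (p := fun c : Nat.Partrec.Code => (u.eval [Encodable.encode c]).Dom)
    ?_ h2
  exact ComputablePred.computable_of_manyOneReducible (q := fun n : ℕ => (u.eval [n]).Dom)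
    ⟨_, Computable.encode, fun _ => Iff.rfl⟩ h

/-- Binary digits come with the least significant one first, so halving removes the head. This
recursion is what makes the initial stack computable. -/
theorem trNat_of_pos {n : ℕ} (hn : n ≠ 0) :
    PartrecToTM2.trNat n =
      (if n % 2 = 0 then PartrecToTM2.Γ'.bit0 else PartrecToTM2.Γ'.bit1) ::
        PartrecToTM2.trNat (n / 2) := by
  have key : ∀ b m, Nat.bit b m ≠ 0 → PartrecToTM2.trNat (Nat.bit b m) =
      (cond b PartrecToTM2.Γ'.bit1 PartrecToTM2.Γ'.bit0) :: PartrecToTM2.trNat m := by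
    intro b m hm
    -- The excluded case is a digit 0 in front of the number 0, which would be a leading zero with
    -- no counterpart in `Num`.
    have hm' : b = true ∨ m ≠ 0 := by
      cases b
      · exact .inr fun h => hm (by simp [h])
      · exact .inl rfl
    rw [PartrecToTM2.trNat, PartrecToTM2.trNat, ← Num.ofNat'_eq, ← Num.ofNat'_eq, Num.ofNat'_bit]
    have h0 : Num.ofNat' m = 0 → m = 0 := by
      intro h
      rw [Num.ofNat'_eq] at h
      exact_mod_cast h
    cases hx : Num.ofNat' m with
    | zero =>
      obtain rfl | h := hm'
      · rfl
      · exact absurd (h0 hx) h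
    | pos p => cases b <;> rfl
  have h1 : n = Nat.bit (decide (n % 2 ≠ 0)) (n / 2) := by
    rw [Nat.bit_val]
    by_cases h : n % 2 = 0
    · simp [h]
      omega
    · simp [h]
      omega
  have h2 := key (decide (n % 2 ≠ 0)) (n / 2) (h1 ▸ hn)
  rw [← h1] at h2
  rw [h2]
  by_cases h : n % 2 = 0 <;> simp [h]

theorem computable_trList {τ : Type*} [Primcodable τ] (g : PartrecToTM2.Γ' → τ) :
    Computable fun n : ℕ => (PartrecToTM2.trList [n]).map g := by
  let f : Unit → ℕ → List τ := fun _ n => (PartrecToTM2.trNat n).map g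
  -- Course-of-values recursion: `l` lists the values at all numbers below `n = l.length`, so its
  -- entry at `l.length / 2` is the value at `n / 2`.
  let G : Unit → List (List τ) → Option (List τ) := fun _ l =>
    if l.length = 0 then some [] else
      l[l.length / 2]?.map fun z => (if l.length % 2 = 0 then g .bit0 else g .bit1) :: z
  have hG : Primrec₂ G := by
    have hlen : Primrec fun p : Unit × List (List τ) => p.2.length :=
      Primrec.list_length.comp Primrec.snd
    have hb : Primrec fun p : Unit × List (List τ) =>
        if p.2.length % 2 = 0 then g .bit0 else g .bit1 :=
      Primrec.ite (Primrec.eq.comp (Primrec.nat_mod.comp hlen (Primrec.const 2))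
        (Primrec.const 0)) (Primrec.const _) (Primrec.const _)
    refine Primrec.ite (Primrec.eq.comp hlen (Primrec.const 0)) (Primrec.const _) ?_
    refine Primrec.option_map (Primrec.list_getElem?.comp Primrec.snd
      (Primrec.nat_div.comp hlen (Primrec.const 2))) ?_
    exact Primrec.list_cons.comp (hb.comp Primrec.fst) Primrec.snd
  have hf : Primrec₂ f := by
    refine Primrec.nat_strong_rec f hG fun a n => ?_
    by_cases hn : n = 0
    · subst hn
      simp [G, f]
    · have h : n / 2 < n := by omega
      simp only [G, f, List.length_map, List.length_range, hn, if_false, List.getElem?_map,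
        List.getElem?_range h, Option.map_some]
      rw [trNat_of_pos hn, List.map_cons]
      split_ifs <;> rfl
  have h : Primrec fun n : ℕ => f () n ++ [g .cons] :=
    Primrec.list_append.comp (hf.comp (Primrec.const ()) Primrec.id) (Primrec.const _)
  exact h.to_comp.of_eq fun n => by simp [f]

instance : Finite PartrecToTM2.K' :=
  Finite.of_surjective (fun i : Fin 4 => match i with
    | 0 => PartrecToTM2.K'.main
    | 1 => .rev
    | 2 => .aux
    | 3 => .stack) fun k => by
      cases k
      exacts [⟨0, rfl⟩, ⟨1, rfl⟩, ⟨2, rfl⟩, ⟨3, rfl⟩]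

/-- The statements of `Turing.PartrecToTM2.tr`. -/
def partrecStmt : PartrecToTM2.Λ' →
    TM2.Stmt (fun _ : PartrecToTM2.K' => PartrecToTM2.Γ') PartrecToTM2.Λ'
      (Option PartrecToTM2.Γ') :=
  PartrecToTM2.tr

/-- The machine simulates the compiled universal program, and the input word is the encoded argument
as content of the main stack; the other stacks start empty. The word is computable only as a list of
numbers through `e`, which is the form needed for tags. -/
theorem exists_queueMachine_not_computablePred :
    ∃ (Q Γ : Type) (_ : Fintype Q) (_ : Fintype Γ) (M : QueueMachine Q Γ) (x : ℕ → List Γ)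
      (e : Γ ↪ ℕ), (∀ n, ∀ A ∈ x n, A ∈ M.input) ∧ (Computable fun n => (x n).map e) ∧
      ¬ ComputablePred fun n => M.Accepts (x n) := by
  obtain ⟨u, hu⟩ := exists_code_not_computablePred
  let k₀ := PartrecToTM2.Cont'.halt
  -- `TM2.Supports` and the start state of `simMachine` refer to the default label, so the default
  -- is chosen to be the entry point of `u`.
  let : Inhabited PartrecToTM2.Λ' := ⟨PartrecToTM2.trNormal u k₀⟩
  have hS : TM2.Supports partrecStmt (PartrecToTM2.codeSupp u k₀) :=
    PartrecToTM2.tr_supports u k₀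
  have := (finite_simStates partrecStmt (PartrecToTM2.codeSupp u k₀)).to_subtype
  let := Fintype.ofFinite (simStates partrecStmt (PartrecToTM2.codeSupp u k₀))
  let := Fintype.ofFinite (Option (PartrecToTM2.K' × PartrecToTM2.Γ'))
  obtain ⟨e⟩ : Nonempty (Option (PartrecToTM2.K' × PartrecToTM2.Γ') ↪ ℕ) :=
    ⟨(Fintype.equivFin _).toEmbedding.trans Fin.valEmbedding⟩
  refine ⟨_, _, inferInstance, inferInstance, simMachine partrecStmt hS none,
    fun n => ((PartrecToTM2.trList [n]).map (Prod.mk PartrecToTM2.K'.main)).map some, e,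
    ?_, ?_, ?_⟩
  · intro n A hA
    obtain ⟨p, -, rfl⟩ := List.mem_map.1 hA
    exact Option.some_ne_none p
  · simpa only [List.map_map] using computable_trList _
  · refine fun h => hu (h.of_eq fun n => ?_)
    rw [simMachine_accepts_iff]
    have h1 : (fun k => stackOf k ((PartrecToTM2.trList [n]).map
        (Prod.mk PartrecToTM2.K'.main))) =
        PartrecToTM2.K'.elim (PartrecToTM2.trList [n]) [] [] [] := by
      funext k
      cases k <;> simp [stackOf, List.filterMap_map]
    rw [h1]
    -- The evaluation of the compiled program is the image of `u.eval [n]` under a total map, which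
    -- has the same domain.
    exact (congrArg Part.Dom (PartrecToTM2.tr_eval u [n])).to_iff

end SessionTypes

namespace SessionTypes

open Relation

/-! ### Finite presentations -/

/-- Related unknowns have the same solution, if their equations have the same shape and relate the
unknowns that follow. -/
theorem solve_eq_solve {X Y : Type*} (eqs : X → Rhs X) (eqs' : Y → Rhs Y) (R : X → Y → Prop)
    (hR : ∀ x y, R x y → (eqs x = .fin ∧ eqs' y = .fin) ∨
      ∃ p I h k k', eqs x = .choice p I h k ∧ eqs' y = .choice p I h k' ∧
        ∀ a ∈ I, R (k a) (k' a)) {x : X} {y : Y} (h : R x y) : solve eqs x = solve eqs' y := by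
  refine PFunctor.M.bisim (fun S T => ∃ x y, R x y ∧ S = solve eqs x ∧ T = solve eqs' y) ?_ _ _
    ⟨x, y, h, rfl, rfl⟩
  rintro _ _ ⟨x, y, h, rfl, rfl⟩
  obtain ⟨h1, h2⟩ | ⟨p, I, h, k, k', h1, h2, h3⟩ := hR x y h
  · rw [solve_fin _ _ h1, solve_fin _ _ h2]
    exact ⟨_, _, _, rfl, rfl, fun i => i.elim⟩
  · rw [solve_choice _ _ _ _ _ _ h1, solve_choice _ _ _ _ _ _ h2]
    exact ⟨_, _, _, rfl, rfl, fun i => ⟨_, _, h3 i.1 i.2, rfl, rfl⟩⟩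

/-- The syntactic part of well-formedness of a system of equations. -/
def EqSystem.Closed (E : EqSystem) : Prop :=
  ∀ (b : Bool) (l : List (ℕ × ℕ)), some (b, l) ∈ E →
    l ≠ [] ∧ (l.map Prod.fst).Nodup ∧ ∀ e ∈ l, e.2 < E.length

theorem EqSystem.rhs_none {E : EqSystem} {n : ℕ} (h : E[n]? = some none) : E.rhs n = .fin := by
  simp [EqSystem.rhs, h]

theorem EqSystem.rhs_some {E : EqSystem} {n : ℕ} {b : Bool} {l : List (ℕ × ℕ)}
    (h : E[n]? = some (some (b, l))) {I : Finset Tag} (hl : (l.map Prod.fst).toFinset = I)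
    (hI : I.Nonempty) :
    E.rhs n = .choice (if b then .out else .inp) I hI fun a => (l.lookup a).getD 0 := by
  subst hl
  simp only [EqSystem.rhs, h]
  rw [dif_pos hI]

theorem exists_lookup {l : List (ℕ × ℕ)} {a : ℕ} (h : a ∈ l.map Prod.fst) :
    ∃ m, l.lookup a = some m ∧ (a, m) ∈ l := by
  induction l with
  | nil => simp at h
  | cons c l ih =>
    obtain ⟨b, m⟩ := c
    by_cases hab : a = b
    · subst hab
      exact ⟨m, by simp, by simp⟩
    · obtain ⟨m', h1, h2⟩ := ih (by simpa [hab] using h)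
      refine ⟨m', ?_, List.mem_cons_of_mem _ h2⟩
      rw [List.lookup_cons, beq_eq_false_iff_ne.2 hab]
      exact h1

/-- The unknowns reachable from `n` stay within the closed system `E`, so the appended equations are
never consulted. -/
theorem EqSystem.Closed.tree_append {E : EqSystem} (hE : E.Closed) (E' : EqSystem) {n : ℕ}
    (hn : n < E.length) : Code.tree (E ++ E', n) = Code.tree (E, n) := by
  refine solve_eq_solve _ _ (fun x y => x = y ∧ y < E.length) ?_ ⟨rfl, hn⟩
  rintro x y ⟨rfl, hx⟩
  have h0 : (E ++ E')[x]? = E[x]? := List.getElem?_append_left hx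
  cases h1 : E[x] with
  | none =>
    have h2 : E[x]? = some none := by rw [List.getElem?_eq_getElem hx, h1]
    exact .inl ⟨EqSystem.rhs_none (h0.trans h2), EqSystem.rhs_none h2⟩
  | some bl =>
    obtain ⟨b, l⟩ := bl
    have h2 : E[x]? = some (some (b, l)) := by rw [List.getElem?_eq_getElem hx, h1]
    obtain ⟨h3, -, h4⟩ := hE b l (h1 ▸ List.getElem_mem hx)
    have h5 : (l.map Prod.fst).toFinset.Nonempty := by simpa using h3
    refine .inr ⟨_, _, h5, _, _, EqSystem.rhs_some (h0.trans h2) rfl h5,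
      EqSystem.rhs_some h2 rfl h5, fun a ha => ⟨rfl, ?_⟩⟩
    obtain ⟨m, h6, h7⟩ := exists_lookup (List.mem_toFinset.1 ha)
    simpa [h6] using h4 _ h7

/-- A presentation of `! a . S`, given one of `S`. -/
def Code.send (a : Tag) (c : Code) : Code := (c.1 ++ [some (true, [(a, c.2)])], c.1.length)

theorem Code.closed_send (a : Tag) {c : Code} (hc : c.2 < c.1.length) (hE : c.1.Closed) :
    (Code.send a c).2 < (Code.send a c).1.length ∧ (Code.send a c).1.Closed := by
  refine ⟨by simp [Code.send], fun b l h => ?_⟩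
  simp only [Code.send, List.mem_append, List.mem_singleton, List.length_append,
    List.length_singleton] at h ⊢
  obtain h | h := h
  · obtain ⟨h1, h2, h3⟩ := hE b l h
    exact ⟨h1, h2, fun e he => (h3 e he).trans (Nat.lt_succ_self _)⟩
  · cases h
    simp
    omega

theorem Code.tree_send (a : Tag) {c : Code} (hc : c.2 < c.1.length) (hE : c.1.Closed) :
    (Code.send a c).tree = Tree.send a c.tree := by
  have h1 : (Code.send a c).1[(Code.send a c).2]? = some (some (true, [(a, c.2)])) := by
    simp [Code.send]
  refine (solve_choice _ _ _ _ _ _ (EqSystem.rhs_some h1 (I := {a}) (by simp)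
    (Finset.singleton_nonempty a))).trans (Tree.choice_congr fun b hb => ?_)
  rw [Finset.mem_singleton.1 hb]
  have h2 := hE.tree_append [some (true, [(a, c.2)])] hc
  simp only [List.lookup_cons_self, Option.getD_some]
  exact h2

/-- A presentation of `! a₁ . ⋯ . ! aₙ . S`, given one of `S`. -/
def Code.sendAll (w : List Tag) (c : Code) : Code := w.foldr Code.send c

theorem Code.closed_sendAll (w : List Tag) {c : Code} (hc : c.2 < c.1.length)
    (hE : c.1.Closed) :
    ((Code.sendAll w c).2 < (Code.sendAll w c).1.length ∧ (Code.sendAll w c).1.Closed) ∧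
      (Code.sendAll w c).tree = Tree.sendAll w c.tree := by
  induction w with
  | nil => exact ⟨⟨hc, hE⟩, rfl⟩
  | cons a w ih =>
    obtain ⟨⟨h1, h2⟩, h3⟩ := ih
    refine ⟨Code.closed_send a h1 h2, ?_⟩
    have h4 := Code.tree_send a h1 h2
    rw [h3] at h4
    exact h4

theorem Code.primrec_sendAll (c : Code) : Primrec fun w : List Tag => Code.sendAll w c := by
  have hsend : Primrec₂ fun (_ : List Tag) (p : ℕ × Code) => Code.send p.1 p.2 := by
    have h1 : Primrec fun q : List Tag × ℕ × Code => q.2.1 := Primrec.fst.comp Primrec.snd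
    have h2 : Primrec fun q : List Tag × ℕ × Code => q.2.2.1 :=
      Primrec.fst.comp (Primrec.snd.comp Primrec.snd)
    have h3 : Primrec fun q : List Tag × ℕ × Code => q.2.2.2 :=
      Primrec.snd.comp (Primrec.snd.comp Primrec.snd)
    have h4 : Primrec fun q : List Tag × ℕ × Code => [some (true, [(q.2.1, q.2.2.2)])] :=
      Primrec.list_cons.comp (Primrec.option_some.comp (Primrec.pair (Primrec.const true)
        (Primrec.list_cons.comp (Primrec.pair h1 h3) (Primrec.const [])))) (Primrec.const [])
    exact Primrec.pair (Primrec.list_append.comp h2 h4) (Primrec.list_length.comp h2)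
  exact Primrec.list_foldr Primrec.id (Primrec.const c) hsend

/-- A system of equations that needs finitely many unknowns has a finite presentation. -/
theorem exists_eqSystem {X : Type*} (eqs : X → Rhs X) {F : Set X} (hF : F.Finite)
    (hclosed : ∀ x ∈ F, ∀ p I h k, eqs x = .choice p I h k → ∀ a ∈ I, k a ∈ F) :
    ∃ (E : EqSystem) (f : X → ℕ), E.Closed ∧
      ∀ x ∈ F, f x < E.length ∧ Code.tree (E, f x) = solve eqs x := by
  classical
  let L : List X := hF.toFinset.toList
  have hL : ∀ x, x ∈ L ↔ x ∈ F := fun x => by simp [L]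
  let f : X → ℕ := fun x => L.idxOf x
  let entry : Rhs X → Option (Bool × List (ℕ × ℕ)) := fun r => match r with
    | .fin => none
    | .choice p I _ k => some (match p with
        | .inp => false
        | .out => true, I.toList.map fun a => (a, f (k a)))
  let E : EqSystem := L.map fun x => entry (eqs x)
  have hlen : E.length = L.length := List.length_map _
  have hf : ∀ x ∈ F, f x < E.length := fun x hx => by
    rw [hlen]
    exact List.idxOf_lt_length_of_mem ((hL x).2 hx)
  have hget : ∀ x ∈ F, E[f x]? = some (entry (eqs x)) := fun x hx => by
    rw [List.getElem?_map, List.getElem?_idxOf ((hL x).2 hx)]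
    rfl
  refine ⟨E, f, fun b l h => ?_, fun x hx => ⟨hf x hx, ?_⟩⟩
  · obtain ⟨x, hx, he⟩ := List.mem_map.1 h
    have hx := (hL x).1 hx
    cases hr : eqs x with
    | fin => simp [entry, hr] at he
    | choice p I hI k =>
      simp only [entry, hr, Option.some.injEq, Prod.mk.injEq] at he
      obtain ⟨-, rfl⟩ := he
      refine ⟨by simpa using hI.ne_empty, ?_, ?_⟩
      · simpa [List.map_map, Function.comp_def] using I.nodup_toList
      · intro e he
        obtain ⟨a, ha, rfl⟩ := List.mem_map.1 he
        exact hf _ (hclosed x hx p I hI k hr a (Finset.mem_toList.1 ha))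
  · refine solve_eq_solve _ _ (fun n x => x ∈ F ∧ n = f x) ?_ ⟨hx, rfl⟩
    rintro _ x ⟨hx, rfl⟩
    have h1 := hget x hx
    cases hr : eqs x with
    | fin => exact .inl ⟨EqSystem.rhs_none (by simpa [entry, hr] using h1), rfl⟩
    | choice p I hI k =>
      simp only [hr, entry] at h1
      refine .inr ⟨_, I, hI, _, k, EqSystem.rhs_some h1 ?_ hI, ?_, fun a ha =>
        ⟨hclosed x hx p I hI k hr a ha, ?_⟩⟩
      · simp [List.map_map, Function.comp_def]
      · cases p <;> rfl
      · rw [List.lookup_graph _ (Finset.mem_toList.2 ha)]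
        rfl

/-! ### Finite presentations of the machine and the forwarder -/

section Encoding

variable {Q Γ : Type} [Fintype Q] [Fintype Γ] (M : QueueMachine Q Γ) (e : Γ ↪ Tag) (E E' : Tag)

theorem exists_code_machineType (p : Q) :
    ∃ c : Code, c.2 < c.1.length ∧ c.1.Closed ∧ c.tree = machineType M e E E' p := by
  -- The pending outputs that occur are suffixes of answers of the machine; there are finitely many,
  -- and they are closed under removing the head.
  let W : Set (List Tag) :=
    {w | w <:+ [E]} ∪ ⋃ (p : Q) (A : Γ), {w | w <:+ (M.δ p A).2.map e}
  have hfin : ∀ l : List Tag, {w | w <:+ l}.Finite := fun l =>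
    l.tails.finite_toSet.subset fun w hw => (List.mem_tails w l).2 hw
  have hW : W.Finite :=
    (hfin _).union (Set.finite_iUnion fun p => Set.finite_iUnion fun A => hfin _)
  have hnil : [] ∈ W := .inl (List.nil_suffix)
  have hδ : ∀ p A, (M.δ p A).2.map e ∈ W := fun p A =>
    .inr (Set.mem_iUnion₂.2 ⟨p, A, List.suffix_rfl⟩)
  have htail : ∀ a w, a :: w ∈ W → w ∈ W := by
    rintro a w (h | h)
    · exact .inl ((List.suffix_cons a w).trans h)
    · obtain ⟨p, A, h⟩ := Set.mem_iUnion₂.1 h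
      exact .inr (Set.mem_iUnion₂.2 ⟨p, A, (List.suffix_cons a w).trans h⟩)
  obtain ⟨S, f, h1, h2⟩ := exists_eqSystem (machineEqs M e E E')
    (F := W ×ˢ (Set.univ : Set (Option Q))) (hW.prod Set.finite_univ) (by
      rintro ⟨w, s⟩ ⟨hw, -⟩ p I h k hk a ha
      refine ⟨?_, trivial⟩
      cases w with
      | cons b w =>
        cases hk
        exact htail b w hw
      | nil =>
        cases s with
        | none => cases hk
        | some q =>
          cases hk
          dsimp only
          split_ifs
          · exact .inl List.suffix_rfl
          · exact hnil
          · cases Function.partialInv e a with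
            | none => exact hnil
            | some A => exact hδ q A)
  obtain ⟨h3, h4⟩ := h2 ([], some p) ⟨hnil, trivial⟩
  exact ⟨(S, f ([], some p)), h3, h1, h4⟩

/-- Only the fixed part of the forwarder is presented here, with pending words of at most one tag;
the prefix that depends on the input is added by `Code.sendAll`, uniformly computably. -/
theorem exists_code_forwarderMain :
    ∃ c : Code, c.2 < c.1.length ∧ c.1.Closed ∧ c.tree = forwarderMain e E E' := by
  let W : Set (List Tag) := insert [] ((fun a => [a]) '' (machineTags e E E' : Set Tag))
  have hW : W.Finite := ((Finset.finite_toSet _).image _).insert _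
  have hmem : ∀ a ∈ machineTags e E E', [a] ∈ W := fun a ha => .inr ⟨a, ha, rfl⟩
  have hsub : ∀ a ∈ forwarderTags e E, a ∈ machineTags e E E' := fun a ha =>
    Finset.mem_insert_of_mem ha
  have hE : E ∈ machineTags e E E' := by simp [machineTags]
  have hE' : E' ∈ machineTags e E E' := by simp [machineTags]
  have hfin : (Set.univ : Set ForwarderState).Finite :=
    (Set.toFinite {ForwarderState.main, .seen, .halt}).subset fun s _ => by cases s <;> simp
  obtain ⟨S, f, h1, h2⟩ := exists_eqSystem (forwarderEqs e E E')
    (F := W ×ˢ (Set.univ : Set ForwarderState)) (hW.prod hfin) (by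
      rintro ⟨w, s⟩ ⟨hw, -⟩ p I h k hk a ha
      refine ⟨?_, trivial⟩
      cases w with
      | cons b w =>
        cases hk
        obtain h | ⟨c, -, h⟩ := hw
        · cases h
        · cases h
          exact .inl rfl
      | nil =>
        cases s with
        | halt => cases hk
        | main =>
          cases hk
          dsimp only
          split_ifs
          · exact hmem _ hE
          · exact hmem _ (hsub a ha)
        | seen =>
          cases hk
          dsimp only
          split_ifs
          · exact hmem _ hE'
          · exact hmem _ (hsub a ha))
  obtain ⟨h3, h4⟩ := h2 ([], .main) ⟨.inl rfl, trivial⟩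
  exact ⟨(S, f ([], .main)), h3, h1, h4⟩

end Encoding

/-- A property that characterizes acceptance of queue machines is undecidable. -/
theorem undecidableOnSessionTypes (P : Tree → Tree → Prop)
    (hP : ∀ (Q Γ : Type) [Fintype Q] [Fintype Γ] (M : QueueMachine Q Γ) (e : Γ ↪ Tag) (E E' : Tag),
      E ∉ Set.range e → E' ∉ Set.range e → E ≠ E' → ∀ x : List Γ,
        (M.Accepts x ↔ P (machineType M e E E' M.start) (forwarderType M e E E' x))) :
    UndecidableOnSessionTypes P := by
  classical
  rintro ⟨f, hf, H⟩
  obtain ⟨Q, Γ, _, _, M, x, e, -, hx, hM⟩ := exists_queueMachine_not_computablePred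
  obtain ⟨E, hE⟩ := Infinite.exists_notMem_finset (Finset.univ.map e)
  obtain ⟨E', hE'⟩ := Infinite.exists_notMem_finset (insert E (Finset.univ.map e))
  have hE1 : E ∉ Set.range e := by simpa using hE
  rw [Finset.mem_insert, not_or] at hE'
  have hE2 : E' ∉ Set.range e := by simpa using hE'.2
  have hEE' : E ≠ E' := Ne.symm hE'.1
  obtain ⟨c, hc1, hc2, hc3⟩ := exists_code_machineType M e E E' M.start
  obtain ⟨d, hd1, hd2, hd3⟩ := exists_code_forwarderMain e E E'
  let w : ℕ → List Tag := fun n => (x n).map e ++ [e M.dollar, E]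
  have hw : Computable w := (Primrec.list_append.comp Primrec.id (Primrec.const _)).to_comp.comp hx
  have hcode : Computable fun n => (c, Code.sendAll (w n) d) :=
    (Computable.const c).pair ((Code.primrec_sendAll d).to_comp.comp hw)
  have htree : ∀ n, (Code.sendAll (w n) d).tree = forwarderType M e E E' (x n) := fun n => by
    rw [(Code.closed_sendAll (w n) hd1 hd2).2, hd3]
    rfl
  refine hM ⟨fun n => Classical.dec _, ?_⟩
  -- The presentations are well formed for every `n`, so the partial algorithm `f` halts on all of
  -- them and computes a total decision function for acceptance.
  refine (hf.comp hcode).of_eq fun n => ?_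
  obtain ⟨h1, h2⟩ := (Code.closed_sendAll (w n) hd1 hd2).1
  obtain ⟨b, hb, hbP⟩ := H c (Code.sendAll (w n) d)
    ⟨hc1, hc2, hc3 ▸ isSessionType_machineType M e E E' hEE' M.start⟩
    ⟨h1, h2, htree n ▸ isSessionType_forwarderType M e E E' (x n)⟩
  rw [hc3, htree, ← hP Q Γ M e E E' hE1 hE2 hEE'] at hbP
  refine (Part.eq_some_iff.2 hb).trans (congrArg Part.some ?_)
  by_cases h : M.Accepts (x n)
  · simp [h, hbP.2 h]
  · simpa [h] using fun hb => h (hbP.1 hb)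

end SessionTypes

theorem mainTheorem4 :
    SessionTypes.UndecidableOnSessionTypes SessionTypes.CorrectComposition ∧
    SessionTypes.UndecidableOnSessionTypes SessionTypes.Compliant ∧
    ∀ (Q Γ : Type) [Fintype Q] [Fintype Γ] (M : SessionTypes.QueueMachine Q Γ)
      (e : Γ ↪ SessionTypes.Tag) (E E' : SessionTypes.Tag),
      E ∉ Set.range e → E' ∉ Set.range e → E ≠ E' →
      (∀ p : Q, SessionTypes.IsSessionType (SessionTypes.machineType M e E E' p)) ∧
      ∀ x : List Γ, (∀ A ∈ x, A ∈ M.input) →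
        SessionTypes.IsSessionType (SessionTypes.forwarderType M e E E' x) ∧
        (M.Accepts x ↔
          SessionTypes.CorrectComposition
            (SessionTypes.machineType M e E E' M.start)
            (SessionTypes.forwarderType M e E E' x)) ∧
        (M.Accepts x ↔
          SessionTypes.Compliant
            (SessionTypes.machineType M e E E' M.start)
            (SessionTypes.forwarderType M e E E' x)) := by
  refine ⟨?_, ?_, ?_⟩
  · exact SessionTypes.undecidableOnSessionTypes _ fun Q Γ _ _ M e E E' hE hE' hEE' x =>
      SessionTypes.accepts_iff_correctComposition hE hE' hEE' x
  · exact SessionTypes.undecidableOnSessionTypes _ fun Q Γ _ _ M e E E' hE hE' hEE' x =>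
      SessionTypes.accepts_iff_compliant hE hE' hEE' x
  · intro Q Γ _ _ M e E E' hE hE' hEE'
    exact ⟨SessionTypes.isSessionType_machineType M e E E' hEE', fun x _ =>
      ⟨SessionTypes.isSessionType_forwarderType M e E E' x,
        SessionTypes.accepts_iff_correctComposition hE hE' hEE' x,
        SessionTypes.accepts_iff_compliant hE hE' hEE' x⟩⟩
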